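/- **Setting.** Let $d,l,k$ be integers with $d\ge 2$ and $k\ge l\ge 2$, let $p\in(\max\{1,\tfrac{2d}{d+2(l-1)}\},2]$ and $\gamma_{p,d}=\tfrac12 d(p-2)$. Let $\Omega\subset\mathbb R^d$ be a bounded open set with open subsets $\Omega_1,\Omega_2$ such that $\overline\Omega=\overline\Omega_1\cup\overline\Omega_2$ and $\Omega_1\cap\Omega_2=\emptyset$. Put $\Omega_l=\Omega_1$, and let $\Omega_g,\Omega_r\subset\Omega_2$ be disjoint open sets (the gap and the right subdomain) with $\overline\Omega_2=\overline\Omega_g\cup\overline\Omega_r$. The face $F_l=\overline\Omega_1\cap\overline\Omega_2$ lies in a hyperplane, with unit normal $n_{F_l}$ that is the outward normal of $\Omega_l$ on $F_l$. The opposite face is $F_r=\Phi_{l,r}(F_l)\subset\partial\Omega_r$, where $\Phi_{l,r}(x)=x+d_g\zeta(x)n_{F_l}$, $d_g>0$, $0\le\zeta\le1$, $\max\zeta=1$ and $\zeta$ is Lipschitz on $F_l$ with constant $M$. Let $\Phi_{r,l}:F_r\to F_l$ be the inverse of $\Phi_{l,r}$. Assume $\partial\Omega_g=F_l\cup F_r$,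 that the segments $[x,\Phi_{l,r}(x)]$, $x\in F_l$, lie in $\overline\Omega_g$, and that $\partial\Omega_i\subset\partial\Omega\cup F_i$ for $i=l,r$. Let $n_i$ be the outward unit normal of $\Omega_i$ on $\partial\Omega_i$; $d\sigma$ is surface measure. For $i=l,r$, $\Omega_i=\Phi_i((0,1)^d)$, where $\Phi_i$ has components in a tensor-product B-spline space $\hat{\mathbb B}_i$ of degree $k$, on knot vectors in $[0,1]$ whose interior knots have multiplicity at most $k$, and is bi-Lipschitz on $(0,1)^d$ with constant $L$. The micro elements of patch $i$ are the products of its nonempty knot spans, $h_i$ is the largest diameter of a micro element of patch $i$, and $h=\max\{h_l,h_r\}$. The meshes are quasi-uniform with constant $\theta$: the diameters of any two elements of a patch, the diameter of an element and each of its edges, and $h_l$ and $h_r$, are comparable up to the factor $\theta$. Finally $d_g\le h^\lambda$, $\lambda\ge1$. Let $\rho_l,\rho_r>0$ and $\rho_g=\rho_r$ be the values of the diffusion coefficient in $\Omega_l$, $\Omega_r$, $\Omega_g$, and $\{\rho\}|_{F_i}=\tfrac12(\rho_i+\rho_g)$. Let $V=W^{1,2}(\Omega)\cap\{v: v|_{\Omega_j}\in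 W^{l,p}(\Omega_j),\ j=1,2\}$ and let $V_h$ be the space of functions $v$ on $\Omega_l\cup\Omega_r$ with $v|_{\Omega_i}\circ\Phi_i\in\hat{\mathbb B}_i$ for $i=l,r$. For $u\in V+V_h$ write $u_i=u|_{\Omega_i}$, let $\nabla u_i$ be the weak gradient, and on $\partial\Omega_i$ understand $u_i$ and $\nabla u_i$ as traces. Put $$\|u\|_{dG}^2=\sum_{i=l,r}\Big(\rho_i\|\nabla u_i\|^2_{L^2(\Omega_i)}+\frac{\rho_i}{h}\|u_i\|^2_{L^2(\partial\Omega_i\cap\partial\Omega)}+\frac{\{\rho\}}{h}\|u_i\|^2_{L^2(F_i)}\Big)$$ and, for $\phi_h\in V_h$ and with $j$ the index in $\{l,r\}$ other than $i$ and $\Phi_{i,j}:F_i\to F_j$ as above, $$\begin{aligned}B_h(u,\phi_h)=\sum_{i=l,r}\Big(&\int_{\Omega_i}\rho_i\nabla u_i\cdot\nabla\phi_{h,i}\,dx-\int_{\partial\Omega_i\cap\partial\Omega}\rho_i\nabla u_i\cdot n_i\,\phi_{h,i}\,d\sigma+\frac{\rho_i}{h}\int_{\partial\Omega_i\cap\partial\Omega}u_i\phi_{h,i}\,d\sigma\\&-\int_{F_i}\Big[\Big(\frac{\rho_i}2\nabla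 u_i+\frac{\rho_j}2(\nabla u_j)\circ\Phi_{i,j}\Big)\cdot n_i\,\phi_{h,i}-\frac{\{\rho\}}h\big(u_i-u_j\circ\Phi_{i,j}\big)\phi_{h,i}\Big]d\sigma\Big).\end{aligned}$$ **Lemma.** There is a constant $C\ge0$, depending only on $d,k,l,p,\lambda,\theta,L,M,\rho_l,\rho_r$ (in particular not on $h$), such that for every such configuration and all $u\in V+V_h$, $\phi_h\in V_h$, $$|B_h(u,\phi_h)|\le C\Big(\|u\|_{dG}^p+\sum_{i=l,r}h^{1+\gamma_{p,d}}\|\nabla u_i\|^p_{L^p(\partial\Omega_i)}\Big)^{1/p}\|\phi_h\|_{dG}.$$ -/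

import Mathlib

open scoped ContDiff ENNReal MeasureTheory

noncomputable section

namespace DGIgA

/-- The Euclidean space `ℝ^d`. -/
abbrev Space (d : ℕ) : Type := EuclideanSpace ℝ (Fin d)

/-- The surface measure `dσ` on hypersurfaces of `ℝ^d`: the `(d-1)`-dimensional Hausdorff measure,
normalised to agree with Lebesgue measure on hyperplanes. -/
def surf (d : ℕ) : MeasureTheory.Measure (Space d) := μHE[d - 1]

/-! ### Sobolev functions, traces and normals -/

/-- Test functions on `U`: smooth functions with compact support contained in `U`. -/
def IsTest {d : ℕ} (U : Set (Space d)) (φ : Space d → ℝ) : Prop :=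
  ContDiff ℝ ∞ φ ∧ HasCompactSupport φ ∧ tsupport φ ⊆ U

/-- `f ∈ W^{m,q}(U)`: `f ∈ L^q(U)`, and every weak partial derivative
`D_{I 0} ⋯ D_{I (n-1)} f` of order `n ≤ m` exists and belongs to `L^q(U)`. -/
def MemSobolev {d : ℕ} (m : ℕ) (q : ℝ≥0∞) (U : Set (Space d)) (f : Space d → ℝ) : Prop :=
  MeasureTheory.MemLp f q (MeasureTheory.volume.restrict U) ∧
  ∀ n ≤ m, ∀ I : Fin n → Fin d, ∃ g : Space d → ℝ,
    MeasureTheory.MemLp g q (MeasureTheory.volume.restrict U) ∧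
    ∀ φ, IsTest U φ →
      ∫ x in U, f x * iteratedFDeriv ℝ n φ x (fun j => EuclideanSpace.single (I j) 1) =
        (-1) ^ n * ∫ x in U, g x * φ x

/-- `G` is a square-integrable weak gradient of `f` on `U`. -/
def IsWeakGrad {d : ℕ} (U : Set (Space d)) (f : Space d → ℝ) (G : Space d → Space d) : Prop :=
  MeasureTheory.LocallyIntegrableOn f U ∧
  MeasureTheory.MemLp G 2 (MeasureTheory.volume.restrict U) ∧
  ∀ φ, IsTest U φ → ∀ e : Space d,
    ∫ x in U, f x * fderiv ℝ φ x e = - ∫ x in U, inner ℝ (G x) e * φ x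

open Classical in
/-- The weak gradient of `f` on `U`; it is unique up to null sets when it exists. -/
def weakGrad {d : ℕ} (U : Set (Space d)) (f : Space d → ℝ) : Space d → Space d :=
  if h : ∃ G, IsWeakGrad U f G then h.choose else 0

/-- `g ∈ L^q(∂U)` is the trace on `∂U` of the integrable function `w` on `U`: at `σ`-almost every
boundary point `x`, the mean of `‖w - g x‖` over `B(x,r) ∩ U` tends to `0` as `r → 0`. -/
def IsTrace {d : ℕ} {F : Type*} [NormedAddCommGroup F] (q : ℝ≥0∞) (U : Set (Space d))
    (w g : Space d → F) : Prop :=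
  MeasureTheory.IntegrableOn w U ∧
  MeasureTheory.MemLp g q ((surf d).restrict (frontier U)) ∧
  ∀ᵐ x ∂((surf d).restrict (frontier U)),
    Filter.Tendsto (fun r : ℝ => ⨍ y in Metric.ball x r ∩ U, ‖w y - g x‖)
      (nhdsWithin 0 (Set.Ioi 0)) (nhds 0)

open Classical in
/-- The trace of `w` on `∂U`; it is unique up to `σ`-null sets when it exists. -/
def trace {d : ℕ} {F : Type*} [NormedAddCommGroup F] (q : ℝ≥0∞) (U : Set (Space d))
    (w : Space d → F) : Space d → F :=
  if h : ∃ g, IsTrace q U w g then h.choose else 0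

/-- `ν` is the (measure-theoretic) outward unit normal of `U` at `x`: near `x`, the set `U` agrees
with the half-space `{y | ⟪y - x, ν⟫ < 0}` up to a set of vanishing density. -/
def IsOuterNormal {d : ℕ} (U : Set (Space d)) (x ν : Space d) : Prop :=
  ‖ν‖ = 1 ∧
  Filter.Tendsto (fun r : ℝ =>
      MeasureTheory.volume (Metric.ball x r ∩ U ∩ {y | 0 ≤ inner ℝ (y - x) ν}) /
        MeasureTheory.volume (Metric.ball x r))
    (nhdsWithin 0 (Set.Ioi 0)) (nhds 0) ∧
  Filter.Tendsto (fun r : ℝ =>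
      MeasureTheory.volume ((Metric.ball x r \ U) ∩ {y | inner ℝ (y - x) ν ≤ 0}) /
        MeasureTheory.volume (Metric.ball x r))
    (nhdsWithin 0 (Set.Ioi 0)) (nhds 0)

open Classical in
/-- The outward unit normal of `U` at `x` (unique where it exists). -/
def outerNormal {d : ℕ} (U : Set (Space d)) (x : Space d) : Space d :=
  if h : ∃ ν, IsOuterNormal U x ν then h.choose else 0

/-- `‖g‖_{L^p(S)}` for a piece of surface `S`. -/
def surfNorm {d : ℕ} {F : Type*} [NormedAddCommGroup F] (p : ℝ) (S : Set (Space d))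
    (g : Space d → F) : ℝ :=
  (∫ x in S, ‖g x‖ ^ p ∂(surf d)) ^ (1 / p)

/-! ### B-splines -/

/-- The B-spline of degree `k` with index `j` on the knots `ξ`, by the Cox-de Boor recursion
(with the convention `0 / 0 = 0`). -/
def bspline (ξ : ℕ → ℝ) : ℕ → ℕ → ℝ → ℝ
  | 0, j, x => Set.indicator (Set.Ico (ξ j) (ξ (j + 1))) 1 x
  | k + 1, j, x =>
      (x - ξ j) / (ξ (j + (k + 1)) - ξ j) * bspline ξ k j x +
      (ξ (j + (k + 1) + 1) - x) / (ξ (j + (k + 1) + 1) - ξ (j + 1)) * bspline ξ k (j + 1) x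

/-- A knot vector `0 = ξ₀ ≤ ξ₁ ≤ ⋯ ≤ ξ_{n+k} = 1` for `n` B-splines of degree `k`; knots in `(0,1)`
have multiplicity at most `k`, that is, the B-splines are continuous on `(0,1)`.
Only the values `knot 0, …, knot (n + k)` are used. -/
structure KnotVector (k : ℕ) where
  n : ℕ
  knot : ℕ → ℝ
  mono : Monotone knot
  first : knot 0 = 0
  last : knot (n + k) = 1
  mult : ∀ j, 0 < knot j → knot j < 1 → knot j < knot (j + k)

/-- The parametric domain `(0,1)^d`. -/
def cube (d : ℕ) : Set (Space d) := {x | ∀ c, 0 < x c ∧ x c < 1}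

/-- A B-spline patch: a knot vector for each direction, and control points. -/
structure Patch (d k : ℕ) where
  knots : Fin d → KnotVector k
  ctrl : ((c : Fin d) → Fin (knots c).n) → Space d

namespace Patch

variable {d k : ℕ}

/-- The tensor-product B-spline with multi-index `j`. -/
def basis (P : Patch d k) (j : (c : Fin d) → Fin (P.knots c).n) (x : Space d) : ℝ :=
  ∏ c, bspline (P.knots c).knot k (j c) (x c)

/-- The tensor-product B-spline space on the parametric domain. -/
def splineSpace (P : Patch d k) : Submodule ℝ (Space d → ℝ) :=
  Submodule.span ℝ (Set.range P.basis)

/-- The parametrization `Φ`, with the control points as coefficients. -/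
def map (P : Patch d k) (x : Space d) : Space d :=
  ∑ j, P.basis j x • P.ctrl j

/-- The physical subdomain parametrized by the patch. -/
def domain (P : Patch d k) : Set (Space d) := P.map '' cube d

/-- The parametrization is bi-Lipschitz on the parametric domain with constant `L`. -/
def BiLipschitz (P : Patch d k) (L : ℝ) : Prop :=
  ∀ x ∈ cube d, ∀ y ∈ cube d,
    ‖P.map x - P.map y‖ ≤ L * ‖x - y‖ ∧ ‖x - y‖ ≤ L * ‖P.map x - P.map y‖

/-- `j` indexes a micro element: a product of non-empty knot spans. -/
def IsElement (P : Patch d k) (j : Fin d → ℕ) : Prop :=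
  ∀ c, j c < (P.knots c).n + k ∧ (P.knots c).knot (j c) < (P.knots c).knot (j c + 1)

/-- The length of the edge of a micro element in direction `c`. -/
def edge (P : Patch d k) (j : Fin d → ℕ) (c : Fin d) : ℝ :=
  (P.knots c).knot (j c + 1) - (P.knots c).knot (j c)

/-- The micro element with index `j`. -/
def element (P : Patch d k) (j : Fin d → ℕ) : Set (Space d) :=
  {x | ∀ c, (P.knots c).knot (j c) < x c ∧ x c < (P.knots c).knot (j c + 1)}

/-- The mesh size of the patch: the largest diameter of its micro elements. -/
def meshSize (P : Patch d k) : ℝ :=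
  sSup {r | ∃ j, P.IsElement j ∧ r = Metric.diam (P.element j)}

/-- The mesh of the patch is quasi-uniform with constant `θ`: the diameters of any two elements,
and the diameter and the edges of each element, are comparable. -/
def QuasiUniform (P : Patch d k) (θ : ℝ) : Prop :=
  (∀ j j', P.IsElement j → P.IsElement j' →
    Metric.diam (P.element j) ≤ θ * Metric.diam (P.element j')) ∧
  ∀ j, P.IsElement j → ∀ c, Metric.diam (P.element j) ≤ θ * P.edge j c

/-- Discrete functions on the patch: `v = s ∘ Φ⁻¹` on the subdomain, with `s` a spline. -/
def IsDiscrete (P : Patch d k) (v : Space d → ℝ) : Prop :=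
  ∃ s ∈ P.splineSpace, ∀ x ∈ cube d, v (P.map x) = s x

end Patch

/-! ### The decomposition with a gap -/

/-- A domain `Ω`, decomposed into `Ω₁ = Ω_l` and `Ω₂`, where `Ω₂` is covered by the gap `Ω_g` and the
subdomain `Ω_r`. The patches `patch 0` and `patch 1` parametrize `Ω_l` and `Ω_r`. The face
`F_l = Ω̄₁ ∩ Ω̄₂` lies in the hyperplane `⟪ν, x⟫ = c`, and the opposite face is the graph
`F_r = {x + d_g ζ(x) ν | x ∈ F_l}`. -/
structure GapDecomposition (d k : ℕ) where
  Ω : Set (Space d)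
  Ω₂ : Set (Space d)
  gap : Set (Space d)
  patch : Fin 2 → Patch d k
  /-- The unit normal `n_{F_l}` on `F_l`, towards the gap. -/
  ν : Space d
  c : ℝ
  /-- The gap distance `d_g`. -/
  dg : ℝ
  ζ : Space d → ℝ
  isOpen_Ω : IsOpen Ω
  isBounded_Ω : Bornology.IsBounded Ω
  isOpen_Ω₂ : IsOpen Ω₂
  isOpen_gap : IsOpen gap
  isOpen_patch : ∀ i, IsOpen (patch i).domain
  left_subset : (patch 0).domain ⊆ Ω
  Ω₂_subset : Ω₂ ⊆ Ω
  closure_Ω : closure Ω = closure (patch 0).domain ∪ closure Ω₂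
  disjoint_left_Ω₂ : Disjoint (patch 0).domain Ω₂
  gap_subset : gap ⊆ Ω₂
  right_subset : (patch 1).domain ⊆ Ω₂
  closure_Ω₂ : closure Ω₂ = closure gap ∪ closure (patch 1).domain
  disjoint_gap_right : Disjoint gap (patch 1).domain
  norm_ν : ‖ν‖ = 1
  flat : ∀ x ∈ closure (patch 0).domain ∩ closure Ω₂, inner ℝ ν x = c
  normal_left : ∀ᵐ x ∂((surf d).restrict (closure (patch 0).domain ∩ closure Ω₂)),
    IsOuterNormal (patch 0).domain x ν
  dg_pos : 0 < dg
  ζ_mem : ∀ x ∈ closure (patch 0).domain ∩ closure Ω₂, 0 ≤ ζ x ∧ ζ x ≤ 1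
  ζ_max : ∃ x ∈ closure (patch 0).domain ∩ closure Ω₂, ζ x = 1
  segment_gap : ∀ x ∈ closure (patch 0).domain ∩ closure Ω₂, ∀ s ∈ Set.Icc (0 : ℝ) 1,
    x + (s * (dg * ζ x)) • ν ∈ closure gap
  frontier_gap : frontier gap = (closure (patch 0).domain ∩ closure Ω₂) ∪
    (fun x => x + (dg * ζ x) • ν) '' (closure (patch 0).domain ∩ closure Ω₂)
  right_face : (fun x => x + (dg * ζ x) • ν) '' (closure (patch 0).domain ∩ closure Ω₂) ⊆
    frontier (patch 1).domain
  frontier_left : frontier (patch 0).domain ⊆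
    frontier Ω ∪ (closure (patch 0).domain ∩ closure Ω₂)
  frontier_right : frontier (patch 1).domain ⊆
    frontier Ω ∪ (fun x => x + (dg * ζ x) • ν) '' (closure (patch 0).domain ∩ closure Ω₂)

namespace GapDecomposition

variable {d k : ℕ}

/-- The subdomains `Ω_l` (`i = 0`) and `Ω_r` (`i = 1`). -/
def sub (D : GapDecomposition d k) (i : Fin 2) : Set (Space d) := (D.patch i).domain

/-- The face `F_l`, the interface between `Ω₁ = Ω_l` and `Ω₂`. -/
def leftFace (D : GapDecomposition d k) : Set (Space d) := closure (D.sub 0) ∩ closure D.Ω₂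

/-- `Φ_{l,r} : F_l → F_r`. -/
def toRight (D : GapDecomposition d k) (x : Space d) : Space d := x + (D.dg * D.ζ x) • D.ν

/-- `Φ_{r,l} : F_r → F_l`, the projection onto the hyperplane of `F_l`. -/
def toLeft (D : GapDecomposition d k) (x : Space d) : Space d := x - (inner ℝ D.ν x - D.c) • D.ν

/-- `Φ_{r,l}` is inverse to `Φ_{l,r}`. -/
theorem toLeft_toRight (D : GapDecomposition d k) {x : Space d} (hx : x ∈ D.leftFace) :
    D.toLeft (D.toRight x) = x := by
  have h := D.flat x hx
  simp [toLeft, toRight, inner_add_right, inner_smul_right, D.norm_ν, h]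

/-- The faces `F_l` (`i = 0`) and `F_r` (`i = 1`). -/
def face (D : GapDecomposition d k) : Fin 2 → Set (Space d) :=
  ![D.leftFace, D.toRight '' D.leftFace]

/-- The map from `F_i` to the opposite face: `Φ_{l,r}` for `i = 0`, and `Φ_{r,l}` for `i = 1`. -/
def opp (D : GapDecomposition d k) : Fin 2 → Space d → Space d := ![D.toRight, D.toLeft]

/-- The part `∂Ω_i ∩ ∂Ω` of the boundary. -/
def outer (D : GapDecomposition d k) (i : Fin 2) : Set (Space d) :=
  frontier (D.sub i) ∩ frontier D.Ω

/-- The mesh size `h = max (h_l, h_r)`. -/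
def h (D : GapDecomposition d k) : ℝ := max (D.patch 0).meshSize (D.patch 1).meshSize

/-- Uniform regularity: both parametrizations are bi-Lipschitz with constant `L`; the meshes are
quasi-uniform, and their sizes comparable, with constant `θ`; `ζ` is Lipschitz on `F_l` with
constant `M`; and the gap distance satisfies `d_g ≤ h ^ lam`. -/
structure Regular (D : GapDecomposition d k) (L θ M lam : ℝ) : Prop where
  biLipschitz : ∀ i, (D.patch i).BiLipschitz L
  quasiUniform : ∀ i, (D.patch i).QuasiUniform θ
  comparable : ∀ i j, (D.patch i).meshSize ≤ θ * (D.patch j).meshSize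
  lipschitz : ∀ x ∈ D.leftFace, ∀ y ∈ D.leftFace, |D.ζ x - D.ζ y| ≤ M * ‖x - y‖
  gap_le : D.dg ≤ D.h ^ lam

/-- `V = W^{1,2}(Ω) ∩ W^{l,p}(T_H(Ω))`, with `T_H(Ω) = {Ω₁, Ω₂}` and `Ω₁ = Ω_l`. -/
def V (D : GapDecomposition d k) (l : ℕ) (p : ℝ) : Set (Space d → ℝ) :=
  {v | MemSobolev 1 2 D.Ω v ∧ MemSobolev l (ENNReal.ofReal p) (D.sub 0) v ∧
    MemSobolev l (ENNReal.ofReal p) D.Ω₂ v}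

/-- The space `V_h`: splines on each of the disjoint subdomains `Ω_l` and `Ω_r` (the values
elsewhere play no role). -/
def Vh (D : GapDecomposition d k) : Set (Space d → ℝ) :=
  {v | ∀ i, (D.patch i).IsDiscrete v}

/-- The space `V + V_h` (the values outside of `Ω_l` and `Ω_r` play no role). -/
def VplusVh (D : GapDecomposition d k) (l : ℕ) (p : ℝ) : Set (Space d → ℝ) :=
  {u | ∃ v ∈ D.V l p, ∃ w ∈ D.Vh, u = v + w}

/-- `∇u_i` on `Ω_i`. -/
def grad (D : GapDecomposition d k) (u : Space d → ℝ) (i : Fin 2) : Space d → Space d :=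
  weakGrad (D.sub i) u

/-- The trace in `L²(∂Ω_i)` of `u_i`. -/
def bval (D : GapDecomposition d k) (u : Space d → ℝ) (i : Fin 2) : Space d → ℝ :=
  trace 2 (D.sub i) u

/-- The trace in `L^p(∂Ω_i)` of `∇u_i`. -/
def bgrad (D : GapDecomposition d k) (p : ℝ) (u : Space d → ℝ) (i : Fin 2) : Space d → Space d :=
  trace (ENNReal.ofReal p) (D.sub i) (D.grad u i)

/-- `{ρ}` on `F_i`: the mean of `ρ_i` and of the value `ρ_g = ρ_r` in the gap (a part of `Ω₂`). -/
def avgRho (ρ : Fin 2 → ℝ) (i : Fin 2) : ℝ := (ρ i + ρ 1) / 2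

/-- The broken norm `‖u‖_dG`. -/
def dG (D : GapDecomposition d k) (ρ : Fin 2 → ℝ) (u : Space d → ℝ) : ℝ :=
  Real.sqrt (∑ i : Fin 2,
    (ρ i * (∫ x in D.sub i, ‖D.grad u i x‖ ^ 2) +
      ρ i / D.h * (∫ x in D.outer i, (D.bval u i x) ^ 2 ∂(surf d)) +
      avgRho ρ i / D.h * (∫ x in D.face i, (D.bval u i x) ^ 2 ∂(surf d))))

/-- The form `B_h(u, φ)`; the index opposite to `i` is `1 - i`. -/
def B (D : GapDecomposition d k) (ρ : Fin 2 → ℝ) (p : ℝ) (u φ : Space d → ℝ) : ℝ :=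
  ∑ i : Fin 2,
    ((∫ x in D.sub i, ρ i * inner ℝ (D.grad u i x) (D.grad φ i x)) -
      (∫ x in D.outer i,
        ρ i * inner ℝ (D.bgrad p u i x) (outerNormal (D.sub i) x) * D.bval φ i x ∂(surf d)) -
      (∫ x in D.face i,
        (inner ℝ ((ρ i / 2) • D.bgrad p u i x +
              (ρ (1 - i) / 2) • D.bgrad p u (1 - i) (D.opp i x))
            (outerNormal (D.sub i) x) * D.bval φ i x -
          avgRho ρ i / D.h * (D.bval u i x - D.bval u (1 - i) (D.opp i x)) * D.bval φ i x)
        ∂(surf d)) +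
      ρ i / D.h * (∫ x in D.outer i, D.bval u i x * D.bval φ i x ∂(surf d)))

end GapDecomposition

end DGIgA

end

/-! The volume, outer penalty and jump terms are bounded by Cauchy-Schwarz, each factor being
controlled by a summand of the dG norm. The flux terms pair a trace of `∇u` that lies only in `L^p`
with a discrete function `φ`, so Hölder asks for the `L^{p'}` norm of `φ` on the boundary, where `p'
≥ 2`. That norm is interpolated between `L²` and `L^∞`. On the boundary of a patch `‖φ‖²_{L^∞} ≤ C
h^{-(d-1)} ‖φ‖²_{L²}` (`Patch.exists_sq_trace_le`), and `‖φ‖²_{L²} ≤ C h ‖φ‖²_dG`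
(`integral_bval_sq_le`). The resulting power of `h` is `1/2 - (d-1)(1/p - 1/2) = (1 + γ_{p,d})/p`,
exactly the weight on the gradient traces (`exists_integral_mul_bval_le`).

The inverse inequality rests on finite dimensionality. On an element a spline is a polynomial in
each coordinate, and on a face such a polynomial keeps at least half of its maximum over a sub-box
of comparable size (`exists_subbox`). The lower Lipschitz bound of the parametrization gives the
image of that sub-box surface measure at least `c h^{d-1}` (`prod_le_surf_image`), so the `L²` norm
of the trace controls the maximum. Traces are given as limits of averages, so their values are
identified with those of the polynomial pieces through `Patch.nonpos_of_trace`.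

Terms transported from the opposite face cost only a constant: the maps between the faces are
mutually inverse and Lipschitz, uniformly in the configuration because `d_g ≤ h^λ` is bounded
(`exists_lipschitzOnWith_opp`). -/

noncomputable section

namespace DGIgA

/-! ### Polynomials in each coordinate -/

/-- Lipschitz bound for polynomials of degree at most `k` on an interval, in terms of their maximum
(a weak form of the Markov inequality). -/
theorem exists_abs_eval_sub_eval_le (k : ℕ) : ∃ K : ℝ, 0 ≤ K ∧ ∀ P : Polynomial ℝ,
    P.natDegree ≤ k → ∀ a b A : ℝ, (∀ t ∈ Set.Icc a b, |P.eval t| ≤ A) →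
      ∀ s ∈ Set.Icc a b, ∀ t ∈ Set.Icc a b,
        |P.eval s - P.eval t| ≤ K * A * (|s - t| / (b - a)) := by
  -- Any `k + 1` distinct nodes in `[0,1]` would do: a polynomial of degree at most `k` is recovered
  -- from its values there, and only the Lipschitz constants of the Lagrange basis enter `K`.
  set v : Fin (k + 1) → ℝ := fun i => (i : ℝ) / (k + 1) with hv
  have hk : (0 : ℝ) < k + 1 := by positivity
  have hvinj : Function.Injective v := by
    intro i j hij
    have := (div_left_inj' hk.ne').1 hij
    exact Fin.ext (by exact_mod_cast this)
  have hv01 : ∀ i, v i ∈ Set.Icc (0 : ℝ) 1 := by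
    intro i
    refine ⟨by positivity, (div_le_one hk).2 ?_⟩
    have : (i : ℕ) ≤ k + 1 := i.2.le
    exact_mod_cast this
  have hlip : ∀ Q : Polynomial ℝ, ∃ C : ℝ, 0 ≤ C ∧
      ∀ s ∈ Set.Icc (0 : ℝ) 1, ∀ t ∈ Set.Icc (0 : ℝ) 1,
        |Q.eval s - Q.eval t| ≤ C * |s - t| := by
    intro Q
    obtain ⟨C, hC⟩ := isCompact_Icc.exists_bound_of_continuousOn
      (s := Set.Icc (0 : ℝ) 1) (f := fun x => Q.derivative.eval x)
      Q.derivative.continuous.continuousOn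
    refine ⟨C, (norm_nonneg _).trans (hC 0 (by simp)), fun s hs t ht => ?_⟩
    have := (convex_Icc (0 : ℝ) 1).norm_image_sub_le_of_norm_hasDerivWithin_le
      (f := fun x => Q.eval x) (fun x _ => (Q.hasDerivAt x).hasDerivWithinAt)
      (fun x hx => hC x hx) ht hs
    simpa [Real.norm_eq_abs] using this
  choose C hC0 hC using fun i => hlip (Lagrange.basis Finset.univ v i)
  refine ⟨∑ i, C i, Finset.sum_nonneg fun i _ => hC0 i, ?_⟩
  have hunit : ∀ P : Polynomial ℝ, P.natDegree ≤ k → ∀ A : ℝ,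
      (∀ t ∈ Set.Icc (0 : ℝ) 1, |P.eval t| ≤ A) →
      ∀ s ∈ Set.Icc (0 : ℝ) 1, ∀ t ∈ Set.Icc (0 : ℝ) 1,
        |P.eval s - P.eval t| ≤ (∑ i, C i) * A * |s - t| := by
    intro P hP A hA s hs t ht
    have hdeg : P.degree < (Finset.univ : Finset (Fin (k + 1))).card := by
      refine lt_of_le_of_lt Polynomial.degree_le_natDegree ?_
      simp only [Finset.card_univ, Fintype.card_fin]
      exact_mod_cast Nat.lt_succ_of_le hP
    have hP' := Lagrange.eq_interpolate (s := Finset.univ) hvinj.injOn hdeg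
    have hev : ∀ x, P.eval x =
        ∑ i, P.eval (v i) * (Lagrange.basis Finset.univ v i).eval x := by
      intro x
      conv_lhs => rw [hP']
      simp [Lagrange.interpolate_apply, Polynomial.eval_finsetSum]
    rw [hev s, hev t, ← Finset.sum_sub_distrib]
    refine (Finset.abs_sum_le_sum_abs _ _).trans ?_
    rw [Finset.sum_mul, Finset.sum_mul]
    refine Finset.sum_le_sum fun i _ => ?_
    rw [← mul_sub, abs_mul]
    calc _ ≤ A * (C i * |s - t|) :=
          mul_le_mul (hA _ (hv01 i)) (hC i s hs t ht) (abs_nonneg _)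
            ((abs_nonneg _).trans (hA _ (hv01 i)))
      _ = _ := by ring
  intro P hP a b A hA s hs t ht
  rcases eq_or_lt_of_le (hs.1.trans hs.2) with hab | hab
  · have h1 : s = t := by linarith [hs.1, hs.2, ht.1, ht.2]
    simp [h1]
  have hba : 0 < b - a := sub_pos.2 hab
  have hcomp : ∀ x, (P.comp (Polynomial.C a + Polynomial.C (b - a) * Polynomial.X)).eval x =
      P.eval (a + (b - a) * x) := by
    intro x; simp
  have hmem : ∀ x ∈ Set.Icc a b, (x - a) / (b - a) ∈ Set.Icc (0 : ℝ) 1 := fun x hx =>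
    ⟨div_nonneg (by linarith [hx.1]) hba.le, (div_le_one hba).2 (by linarith [hx.2])⟩
  have hback : ∀ x, a + (b - a) * ((x - a) / (b - a)) = x := by
    intro x; field_simp; ring
  have := hunit (P.comp (Polynomial.C a + Polynomial.C (b - a) * Polynomial.X)) ?_ A ?_ _
    (hmem s hs) _ (hmem t ht)
  · rw [hcomp, hcomp, hback, hback, ← sub_div, abs_div, abs_of_pos hba] at this
    simpa using this
  · refine Polynomial.natDegree_comp_le.trans ?_
    have h1 : (Polynomial.C a + Polynomial.C (b - a) * Polynomial.X).natDegree ≤ 1 := by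
      compute_degree
    calc _ ≤ k * 1 := Nat.mul_le_mul hP h1
      _ = k := mul_one k
  · intro x hx
    rw [hcomp]
    exact hA _ ⟨by nlinarith [hx.1], by nlinarith [hx.2]⟩

/-- `q` is continuous, and a polynomial of degree at most `k` in each of its variables. -/
def IsCoordPoly {d : ℕ} (k : ℕ) (q : (Fin d → ℝ) → ℝ) : Prop :=
  Continuous q ∧ ∀ x c, ∃ P : Polynomial ℝ, P.natDegree ≤ k ∧
    ∀ t, q (Function.update x c t) = P.eval t

theorem IsCoordPoly.zero {d k : ℕ} : IsCoordPoly (d := d) k 0 :=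
  ⟨continuous_const, fun _ _ => ⟨0, by simp, by simp⟩⟩

theorem IsCoordPoly.add {d k : ℕ} {q r : (Fin d → ℝ) → ℝ} (hq : IsCoordPoly k q)
    (hr : IsCoordPoly k r) : IsCoordPoly k (q + r) := by
  refine ⟨hq.1.add hr.1, fun x c => ?_⟩
  obtain ⟨P, hP, hP'⟩ := hq.2 x c
  obtain ⟨Q, hQ, hQ'⟩ := hr.2 x c
  exact ⟨P + Q, Polynomial.natDegree_add_le_of_degree_le hP hQ, by simp [hP', hQ']⟩

theorem IsCoordPoly.smul {d k : ℕ} {q : (Fin d → ℝ) → ℝ} (hq : IsCoordPoly k q) (a : ℝ) :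
    IsCoordPoly k (a • q) := by
  refine ⟨hq.1.const_smul a, fun x c => ?_⟩
  obtain ⟨P, hP, hP'⟩ := hq.2 x c
  exact ⟨a • P, (Polynomial.natDegree_smul_le a P).trans hP, by simp [hP']⟩

theorem isCoordPoly_prod {d k : ℕ} {P : Fin d → Polynomial ℝ} (hP : ∀ c, (P c).natDegree ≤ k) :
    IsCoordPoly k fun x => ∏ c, (P c).eval (x c) := by
  refine ⟨continuous_finsetProd _ fun c _ => (P c).continuous.comp (continuous_apply c),
    fun x c => ?_⟩
  refine ⟨Polynomial.C (∏ e ∈ Finset.univ.erase c, (P e).eval (x e)) * P c,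
    (Polynomial.natDegree_C_mul_le _ _).trans (hP c), fun t => ?_⟩
  beta_reduce
  rw [← Finset.prod_erase_mul _ _ (Finset.mem_univ c)]
  simp only [Function.update_self, Polynomial.eval_mul, Polynomial.eval_C]
  congr 1
  refine Finset.prod_congr rfl fun e he => ?_
  rw [Function.update_of_ne (Finset.ne_of_mem_erase he)]

/-- Pass from `x` to `y` one coordinate at a time; all intermediate points stay in the box, so the
one-variable bound applies at each move. A collapsed direction contributes nothing, since division
by zero gives zero; this allows faces of boxes. -/
theorem exists_abs_sub_le_of_isCoordPoly (k : ℕ) : ∃ K : ℝ, 0 ≤ K ∧ ∀ {d : ℕ}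
    (q : (Fin d → ℝ) → ℝ), IsCoordPoly k q → ∀ (a b : Fin d → ℝ) (A : ℝ),
      (∀ z ∈ Set.Icc a b, |q z| ≤ A) → ∀ x ∈ Set.Icc a b, ∀ y ∈ Set.Icc a b,
        |q y - q x| ≤ K * A * ∑ c, |y c - x c| / (b c - a c) := by
  obtain ⟨K, hK0, hK⟩ := exists_abs_eval_sub_eval_le k
  refine ⟨K, hK0, fun {d} q hq a b A hA x hx y hy => ?_⟩
  classical
  have key : ∀ T : Finset (Fin d), |q (T.piecewise y x) - q x| ≤
      K * A * ∑ c ∈ T, |y c - x c| / (b c - a c) := by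
    intro T
    induction T using Finset.induction_on with
    | empty => simp
    | insert c T hc ih =>
      rw [Finset.sum_insert hc, mul_add]
      have hmem : T.piecewise y x ∈ Set.Icc a b := by
        constructor
        · exact Finset.le_piecewise_of_le_of_le _ hy.1 hx.1
        · exact Finset.piecewise_le_of_le_of_le _ hy.2 hx.2
      have hupd : Function.update (T.piecewise y x) c (x c) = T.piecewise y x := by
        rw [Function.update_eq_self_iff]
        simp [hc]
      obtain ⟨P, hP, hPq⟩ := hq.2 (T.piecewise y x) c
      have h1 : |q (Function.update (T.piecewise y x) c (y c)) - q (T.piecewise y x)| ≤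
          K * A * (|y c - x c| / (b c - a c)) := by
        rw [← hupd, Function.update_idem, hPq, hPq]
        refine hK P hP (a c) (b c) A (fun t ht => ?_) _ ⟨hy.1 c, hy.2 c⟩ _ ⟨hx.1 c, hx.2 c⟩
        rw [← hPq]
        refine hA _ ⟨fun e => ?_, fun e => ?_⟩
        · rcases eq_or_ne e c with rfl | he
          · simpa using ht.1
          · simpa [he] using hmem.1 e
        · rcases eq_or_ne e c with rfl | he
          · simpa using ht.2
          · simpa [he] using hmem.2 e
      rw [Finset.piecewise_insert]
      calc _ = |(q (Function.update (T.piecewise y x) c (y c)) - q (T.piecewise y x)) +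
            (q (T.piecewise y x) - q x)| := by ring_nf
        _ ≤ _ := (abs_add_le _ _).trans (add_le_add h1 ih)
  simpa using key Finset.univ

/-- On a box, a function that is a polynomial of degree at most `k` in each variable attains at
least half of its maximum on a sub-box of comparable size. -/
theorem exists_subbox (d k : ℕ) : ∃ δ : ℝ, 0 < δ ∧ ∀ q : (Fin d → ℝ) → ℝ, IsCoordPoly k q →
    ∀ a b : Fin d → ℝ, a ≤ b → ∃ α β : Fin d → ℝ,
      (∀ c, a c < b c → a c < α c ∧ β c < b c ∧ β c - α c = δ * (b c - a c)) ∧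
      ∀ y ∈ Set.Icc a b, (∀ c, a c < b c → y c ∈ Set.Icc (α c) (β c)) →
        ∀ z ∈ Set.Icc a b, |q z| ≤ 2 * |q y| := by
  obtain ⟨K, hK0, hK⟩ := exists_abs_sub_le_of_isCoordPoly k
  -- Chosen so that `d * K * η ≤ 1/2`: within relative distance `η` of a maximum point in each
  -- coordinate, at most half of the maximum is lost. The `+ 1` keeps the denominator positive.
  set η : ℝ := 1 / (2 * (d * K + 1)) with hη
  have hη0 : 0 < η := by positivity
  have hη1 : η ≤ 1 / 2 := by
    rw [hη]
    apply one_div_le_one_div_of_le two_pos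
    nlinarith [show 0 ≤ (d : ℝ) * K by positivity]
  refine ⟨η / 2, half_pos hη0, fun q hq a b hab => ?_⟩
  obtain ⟨z₀, hz₀, hmax⟩ := (isCompact_Icc (a := a) (b := b)).exists_isMaxOn
    ⟨a, le_rfl, hab⟩ (hq.1.abs.continuousOn)
  -- The sub-box lies on the side of the maximum point facing the centre, at relative distance
  -- between `η/4` and `3η/4`. As `η ≤ 1/2`, it stays strictly inside the box even when the maximum
  -- is at a corner; the strictness later isolates a single element.
  refine ⟨fun c => if z₀ c ≤ (a c + b c) / 2 then z₀ c + η / 4 * (b c - a c)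
      else z₀ c - 3 * η / 4 * (b c - a c),
    fun c => if z₀ c ≤ (a c + b c) / 2 then z₀ c + 3 * η / 4 * (b c - a c)
      else z₀ c - η / 4 * (b c - a c), fun c hc => ?_, fun y hy hyc z hz => ?_⟩
  · have h1 := hz₀.1 c
    have h2 := hz₀.2 c
    have h3 : 0 < η * (b c - a c) := mul_pos hη0 (sub_pos.2 hc)
    have h4 : η * (b c - a c) ≤ 1 / 2 * (b c - a c) :=
      mul_le_mul_of_nonneg_right hη1 (sub_pos.2 hc).le
    dsimp only
    split_ifs with h
    · refine ⟨?_, ?_, ?_⟩ <;> nlinarith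
    · push Not at h
      refine ⟨?_, ?_, ?_⟩ <;> nlinarith
  · have hA : ∀ z ∈ Set.Icc a b, |q z| ≤ |q z₀| := fun z hz => hmax hz
    have hdist : ∀ c, |y c - z₀ c| / (b c - a c) ≤ η := by
      intro c
      rcases eq_or_lt_of_le (hab c) with h | h
      · simp [h, hη0.le]
      · have hpos := sub_pos.2 h
        have h3 : 0 < η * (b c - a c) := mul_pos hη0 hpos
        rw [div_le_iff₀ hpos, abs_le]
        have := hyc c h
        dsimp only at this
        split_ifs at this with h'
        · constructor <;> nlinarith [this.1, this.2]
        · constructor <;> nlinarith [this.1, this.2]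
    have h1 := hK q hq a b _ hA z₀ hz₀ y hy
    have h2 : ∑ c, |y c - z₀ c| / (b c - a c) ≤ d * η := by
      refine (Finset.sum_le_sum fun c _ => hdist c).trans ?_
      simp
    have h3 : K * |q z₀| * ∑ c, |y c - z₀ c| / (b c - a c) ≤ |q z₀| / 2 := by
      refine (mul_le_mul_of_nonneg_left h2 (by positivity)).trans ?_
      have : (d * K) * η ≤ 1 / 2 := by
        rw [hη, mul_one_div, div_le_div_iff₀ (by positivity) two_pos]
        linarith
      nlinarith [abs_nonneg (q z₀)]
    have h4 : |q z₀| - |q y| ≤ |q y - q z₀| := by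
      rw [abs_sub_comm]
      exact abs_sub_abs_le_abs_sub _ _
    linarith [hA z hz]

/-! ### Splines on the elements -/

theorem bspline_eq_polynomial {ξ : ℕ → ℝ} (hξ : Monotone ξ) (m k j : ℕ) :
    ∃ P : Polynomial ℝ, P.natDegree ≤ k ∧
      ∀ x ∈ Set.Ico (ξ m) (ξ (m + 1)), bspline ξ k j x = P.eval x := by
  induction k generalizing j with
  | zero =>
    rcases eq_or_ne j m with rfl | hjm
    · exact ⟨1, by simp, fun x hx => by simp [bspline, hx.1, hx.2]⟩
    · refine ⟨0, by simp, fun x hx => ?_⟩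
      have : x ∉ Set.Ico (ξ j) (ξ (j + 1)) := by
        rintro ⟨h1, h2⟩
        rcases lt_or_gt_of_ne hjm with h | h
        · exact (h2.trans_le ((hξ h).trans hx.1)).false
        · exact ((hx.2.trans_le (hξ h)).trans_le h1).false
      simp only [bspline, Set.indicator_of_notMem this, Polynomial.eval_zero]
  | succ k ih =>
    obtain ⟨P, hP, hP'⟩ := ih j
    obtain ⟨Q, hQ, hQ'⟩ := ih (j + 1)
    -- The inverse of zero is zero, so the convention `0 / 0 = 0` at repeated knots needs no
    -- separate case.
    refine ⟨Polynomial.C (ξ (j + (k + 1)) - ξ j)⁻¹ * (Polynomial.X - Polynomial.C (ξ j)) * P +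
      Polynomial.C (ξ (j + (k + 1) + 1) - ξ (j + 1))⁻¹ *
        (Polynomial.C (ξ (j + (k + 1) + 1)) - Polynomial.X) * Q, ?_, fun x hx => ?_⟩
    · refine Polynomial.natDegree_add_le_of_degree_le ?_ ?_
      · refine Polynomial.natDegree_mul_le.trans ?_
        have : (Polynomial.C (ξ (j + (k + 1)) - ξ j)⁻¹ *
          (Polynomial.X - Polynomial.C (ξ j))).natDegree ≤ 1 := by compute_degree
        omega
      · refine Polynomial.natDegree_mul_le.trans ?_
        have : (Polynomial.C (ξ (j + (k + 1) + 1) - ξ (j + 1))⁻¹ *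
          (Polynomial.C (ξ (j + (k + 1) + 1)) - Polynomial.X)).natDegree ≤ 1 := by compute_degree
        omega
    · rw [bspline, hP' x hx, hQ' x hx]
      simp only [Polynomial.eval_add, Polynomial.eval_mul, Polynomial.eval_C,
        Polynomial.eval_sub, Polynomial.eval_X]
      ring

namespace KnotVector

theorem exists_span {k : ℕ} (Ξ : KnotVector k) {t : ℝ} (h0 : 0 ≤ t) (h1 : t < 1) :
    ∃ m < Ξ.n + k, t ∈ Set.Ico (Ξ.knot m) (Ξ.knot (m + 1)) := by
  classical
  -- Taking the last knot not exceeding `t` skips repeated knots, so the span found is nonempty.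
  set m := Nat.findGreatest (fun m => Ξ.knot m ≤ t) (Ξ.n + k) with hm
  have hspec : Ξ.knot m ≤ t :=
    Nat.findGreatest_spec (P := fun m => Ξ.knot m ≤ t) (Nat.zero_le _) (by simpa [Ξ.first])
  have hle : m ≤ Ξ.n + k := Nat.findGreatest_le _
  have hne : m ≠ Ξ.n + k := by
    intro h
    rw [h, Ξ.last] at hspec
    linarith
  have hlt : m < Ξ.n + k := lt_of_le_of_ne hle hne
  refine ⟨m, hlt, hspec, ?_⟩
  have := Nat.findGreatest_is_greatest (P := fun m => Ξ.knot m ≤ t) (Nat.lt_succ_self m) hlt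
  exact not_le.1 this

theorem knot_nonneg {k : ℕ} (Ξ : KnotVector k) (m : ℕ) : 0 ≤ Ξ.knot m :=
  Ξ.first ▸ Ξ.mono (Nat.zero_le m)

theorem knot_le_one {k : ℕ} (Ξ : KnotVector k) {m : ℕ} (hm : m ≤ Ξ.n + k) : Ξ.knot m ≤ 1 :=
  Ξ.last ▸ Ξ.mono hm

end KnotVector

namespace Patch

variable {d k : ℕ}

/-- The lower corner of the element `j`. -/
def lower (P : Patch d k) (j : Fin d → ℕ) (c : Fin d) : ℝ := (P.knots c).knot (j c)

/-- The upper corner of the element `j`. -/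
def upper (P : Patch d k) (j : Fin d → ℕ) (c : Fin d) : ℝ := (P.knots c).knot (j c + 1)

/-- The element `j`, with its lower faces. -/
def cell (P : Patch d k) (j : Fin d → ℕ) : Set (Space d) :=
  {x | ∀ c, x c ∈ Set.Ico (P.lower j c) (P.upper j c)}

theorem exists_cell (P : Patch d k) {x : Space d} (hx : x ∈ cube d) :
    ∃ j, P.IsElement j ∧ x ∈ P.cell j := by
  choose j hj hjx using fun c => (P.knots c).exists_span (hx c).1.le (hx c).2
  exact ⟨j, fun c => ⟨hj c, (hjx c).1.trans_lt (hjx c).2⟩, hjx⟩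

theorem finite_setOf_isElement (P : Patch d k) : {j | P.IsElement j}.Finite :=
  (Set.Finite.pi' fun c => Set.finite_Iio ((P.knots c).n + k)).subset fun _ hj c => (hj c).1

/-- On each element, a spline is a polynomial. -/
theorem exists_isCoordPoly (P : Patch d k) {s : Space d → ℝ} (hs : s ∈ P.splineSpace)
    (j : Fin d → ℕ) : ∃ q : (Fin d → ℝ) → ℝ, IsCoordPoly k q ∧ ∀ x ∈ P.cell j, s x = q x.ofLp := by
  induction hs using Submodule.span_induction with
  | mem s hs =>
    obtain ⟨i, rfl⟩ := hs
    choose R hR hR' using fun c => bspline_eq_polynomial (P.knots c).mono (j c) k (i c)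
    exact ⟨_, isCoordPoly_prod hR, fun x hx => Finset.prod_congr rfl fun c _ => hR' c _ (hx c)⟩
  | zero => exact ⟨0, .zero, fun _ _ => rfl⟩
  | add s t _ _ h1 h2 =>
    obtain ⟨q, hq, hq'⟩ := h1
    obtain ⟨r, hr, hr'⟩ := h2
    exact ⟨q + r, hq.add hr, fun x hx => by simp [hq' x hx, hr' x hx]⟩
  | smul a s _ h =>
    obtain ⟨q, hq, hq'⟩ := h
    exact ⟨a • q, hq.smul a, fun x hx => by simp [hq' x hx]⟩

end Patch

/-! ### The closed cube and the boundary of a patch -/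

/-- The closed parametric domain `[0,1]^d`. -/
def closedCube (d : ℕ) : Set (Space d) := {x | ∀ c, 0 ≤ x c ∧ x c ≤ 1}

theorem cube_subset_closedCube (d : ℕ) : cube d ⊆ closedCube d :=
  fun _ hx c => ⟨(hx c).1.le, (hx c).2.le⟩

theorem isCompact_ofLp_preimage {d : ℕ} {s : Set (Fin d → ℝ)} (hs : IsCompact s) :
    IsCompact ((fun x : Space d => x.ofLp) ⁻¹' s) :=
  ((EuclideanSpace.equiv (Fin d) ℝ).toHomeomorph.isCompact_preimage).2 hs

theorem isCompact_closedCube (d : ℕ) : IsCompact (closedCube d) := by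
  convert isCompact_ofLp_preimage (isCompact_Icc (a := (0 : Fin d → ℝ)) (b := 1)) using 1
  ext x
  simp [closedCube, Pi.le_def, forall_and]

theorem closure_cube (d : ℕ) : closure (cube d) = closedCube d := by
  refine Set.Subset.antisymm
    (closure_minimal (cube_subset_closedCube d) (isCompact_closedCube d).isClosed) fun x hx => ?_
  -- A point of the closed cube is approached along the segment to the centre, which enters the open
  -- cube at once.
  let y : ℝ → Space d := fun t => (1 - t) • x + t • WithLp.toLp 2 (fun _ => (1 / 2 : ℝ))
  have hy : Filter.Tendsto y (nhdsWithin 0 (Set.Ioi 0)) (nhds x) := by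
    have : Continuous y := by fun_prop
    have h := this.tendsto 0
    simp only [y, sub_zero, one_smul, zero_smul, add_zero] at h
    exact h.mono_left nhdsWithin_le_nhds
  refine mem_closure_of_tendsto hy ?_
  filter_upwards [Ioo_mem_nhdsGT (zero_lt_one (α := ℝ))] with t ht c
  have h1 := hx c
  simp only [y, PiLp.add_apply, PiLp.smul_apply, smul_eq_mul]
  constructor <;> nlinarith [ht.1, ht.2]

namespace Patch

variable {d k : ℕ}

/-- The parametrization extends continuously to the closed cube, as a bi-Lipschitz map; the
extension maps the boundary of the cube onto the boundary of the subdomain. -/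
theorem exists_extension (P : Patch d k) {L : ℝ} (hP : P.BiLipschitz L)
    (hU : IsOpen P.domain) : ∃ ψ : Space d → Space d, Continuous ψ ∧
      (∀ x ∈ cube d, ψ x = P.map x) ∧
      (∀ x ∈ closedCube d, ∀ y ∈ closedCube d, ‖x - y‖ ≤ L * ‖ψ x - ψ y‖) ∧
      frontier P.domain = ψ '' (closedCube d \ cube d) := by
  have hlip : LipschitzOnWith L.toNNReal P.map (cube d) := by
    refine LipschitzOnWith.of_dist_le_mul fun x hx y hy => ?_
    rw [dist_eq_norm, dist_eq_norm]
    exact (hP x hx y hy).1.trans (mul_le_mul_of_nonneg_right (Real.le_coe_toNNReal L)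
      (norm_nonneg _))
  obtain ⟨ψ, hψ, hψP⟩ := hlip.extend_finite_dimension
  have hcont := hψ.continuous
  -- The lower bound is a closed condition on pairs of points, so it passes from the open cube to
  -- its closure; it makes `ψ` injective there.
  have hlow : ∀ x ∈ closedCube d, ∀ y ∈ closedCube d, ‖x - y‖ ≤ L * ‖ψ x - ψ y‖ := by
    have hcl : IsClosed {z : Space d × Space d | ‖z.1 - z.2‖ ≤ L * ‖ψ z.1 - ψ z.2‖} :=
      isClosed_le (by fun_prop) (by fun_prop)
    have hsub : cube d ×ˢ cube d ⊆ {z | ‖z.1 - z.2‖ ≤ L * ‖ψ z.1 - ψ z.2‖} := by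
      rintro ⟨x, y⟩ ⟨hx, hy⟩
      simpa [← hψP hx, ← hψP hy] using (hP x hx y hy).2
    intro x hx y hy
    have := closure_minimal hsub hcl (a := (x, y))
    rw [closure_prod_eq, closure_cube] at this
    exact this ⟨hx, hy⟩
  have hdom : P.domain = ψ '' cube d := Set.image_congr fun x hx => hψP hx
  have hcl : closure P.domain = ψ '' closedCube d := by
    rw [hdom, ← closure_cube,
      image_closure_of_isCompact (by rw [closure_cube]; exact isCompact_closedCube d)
        hcont.continuousOn]
  have hinj : Set.InjOn ψ (closedCube d) := by
    intro x hx y hy hxy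
    have := hlow x hx y hy
    rw [hxy, sub_self, norm_zero, mul_zero] at this
    exact sub_eq_zero.1 (norm_le_zero_iff.1 this)
  refine ⟨ψ, hcont, fun x hx => (hψP hx).symm, hlow, ?_⟩
  rw [frontier, hU.interior_eq, hcl, hdom, hinj.image_sdiff_subset (cube_subset_closedCube d)]

end Patch

/-! ### Pointwise values of traces -/

/-- A function takes somewhere a value not above its average, so a lower bound `c` near `x` is a
lower bound for all small averages, and hence for their limit 0. Openness of `U` gives the averaging
sets positive measure. -/
theorem nonpos_of_tendsto_average {d : ℕ} {U : Set (Space d)} (hU : IsOpen U) {x : Space d}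
    (hx : x ∈ frontier U) {f : Space d → ℝ} (hf : MeasureTheory.IntegrableOn f U)
    {a : ℝ}
    (hlim : Filter.Tendsto (fun r : ℝ => ⨍ y in Metric.ball x r ∩ U, ‖f y - a‖)
      (nhdsWithin 0 (Set.Ioi 0)) (nhds 0))
    {r₀ c : ℝ} (hr₀ : 0 < r₀) (hc : ∀ y ∈ Metric.ball x r₀ ∩ U, c ≤ ‖f y - a‖) : c ≤ 0 := by
  refine ge_of_tendsto hlim ?_
  filter_upwards [Ioo_mem_nhdsGT hr₀] with r hr
  have hne : MeasureTheory.volume (Metric.ball x r ∩ U) ≠ 0 := by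
    refine ((Metric.isOpen_ball.inter hU).measure_pos _ ?_).ne'
    exact mem_closure_iff.1 (frontier_subset_closure hx) _ Metric.isOpen_ball
      (Metric.mem_ball_self hr.1)
  have hfin : MeasureTheory.volume (Metric.ball x r ∩ U) ≠ ⊤ :=
    ((MeasureTheory.measure_mono Set.inter_subset_left).trans_lt
      MeasureTheory.measure_ball_lt_top).ne
  have hint : MeasureTheory.IntegrableOn (fun y => ‖f y - a‖) (Metric.ball x r ∩ U) :=
    ((hf.mono_set Set.inter_subset_right).sub
      (MeasureTheory.integrableOn_const hfin)).norm
  obtain ⟨y, hy, hle⟩ := MeasureTheory.exists_le_setAverage hne hfin hint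
  exact (hc y ⟨Metric.ball_subset_ball hr.2.le hy.1, hy.2⟩).trans hle

namespace Patch

variable {d k : ℕ}

/-- The previous bound, pulled back to the parametric domain: by the lower Lipschitz bound, points
of the patch within `r / L` of `ψ z` have parameters within `r` of `z`. This yields both upper
bounds and exact values for a trace at a given point. -/
theorem nonpos_of_trace (P : Patch d k) {L : ℝ} (hL : 0 < L) (hU : IsOpen P.domain)
    {ψ : Space d → Space d} (hψP : ∀ x ∈ cube d, ψ x = P.map x)
    (hlow : ∀ x ∈ closedCube d, ∀ y ∈ closedCube d, ‖x - y‖ ≤ L * ‖ψ x - ψ y‖)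
    {z : Space d} (hz : z ∈ closedCube d) (hzf : ψ z ∈ frontier P.domain)
    {φ s : Space d → ℝ} (hφ : MeasureTheory.IntegrableOn φ P.domain)
    (hφs : ∀ x ∈ cube d, φ (P.map x) = s x) {a : ℝ}
    (hlim : Filter.Tendsto (fun r : ℝ => ⨍ y in Metric.ball (ψ z) r ∩ P.domain, ‖φ y - a‖)
      (nhdsWithin 0 (Set.Ioi 0)) (nhds 0))
    {c : ℝ} (hc : ∀ᶠ y in nhds z, y ∈ cube d → c ≤ |s y - a|) : c ≤ 0 := by
  obtain ⟨r, hr, hball⟩ := Metric.eventually_nhds_iff.1 hc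
  refine nonpos_of_tendsto_average hU hzf hφ hlim (div_pos hr hL) ?_
  rintro _ ⟨hw, y, hy, rfl⟩
  rw [hφs y hy, Real.norm_eq_abs]
  refine hball ?_ hy
  rw [dist_eq_norm]
  refine (hlow y (cube_subset_closedCube d hy) z hz).trans_lt ?_
  rw [hψP y hy, ← dist_eq_norm, mul_comm]
  exact (lt_div_iff₀ hL).1 hw

/-- In the relative interior of a boundary face of an element, no other element comes close:
tangentially there is room on both sides, and in direction `c₀` the cube lies on one side only,
where the element adjoins. -/
theorem eventually_mem_cell (P : Patch d k) {j : Fin d → ℕ} (hj : P.IsElement j) {z : Space d}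
    (c₀ : Fin d) (hz₀ : z c₀ = 0 ∨ z c₀ = 1) (hz : z c₀ ∈ Set.Icc (P.lower j c₀) (P.upper j c₀))
    (hzc : ∀ c ≠ c₀, z c ∈ Set.Ioo (P.lower j c) (P.upper j c)) :
    ∀ᶠ y in nhds z, y ∈ cube d → y ∈ P.cell j := by
  have hcoord : ∀ c, Filter.Tendsto (fun y : Space d => y c) (nhds z) (nhds (z c)) := fun c =>
    (EuclideanSpace.proj (𝕜 := ℝ) c).continuous.tendsto z
  have h : ∀ c, ∀ᶠ y in nhds z, y ∈ cube d → y c ∈ Set.Ico (P.lower j c) (P.upper j c) := by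
    intro c
    rcases eq_or_ne c c₀ with rfl | hne
    · have hlt : P.lower j c < P.upper j c := (hj c).2
      rcases hz₀ with h0 | h1
      · have hlow : P.lower j c ≤ 0 := h0 ▸ hz.1
        have hup : z c < P.upper j c := by
          rw [h0]
          exact ((P.knots c).knot_nonneg _).trans_lt hlt
        filter_upwards [(hcoord c).eventually_lt_const hup] with y hy hyc
        exact ⟨hlow.trans (hyc c).1.le, hy⟩
      · have hup : 1 ≤ P.upper j c := h1 ▸ hz.2
        have hlow : P.lower j c < z c := by
          rw [h1]
          exact hlt.trans_le ((P.knots c).knot_le_one (hj c).1)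
        filter_upwards [(hcoord c).eventually_const_lt hlow] with y hy hyc
        exact ⟨hy.le, (hyc c).2.trans_le hup⟩
    · filter_upwards [(hcoord c).eventually_const_lt (hzc c hne).1,
        (hcoord c).eventually_lt_const (hzc c hne).2] with y h1 h2 _
      exact ⟨h1.le, h2⟩
  filter_upwards [Filter.eventually_all.2 h] with y hy hyc c
  exact hy c hyc

end Patch

/-! ### Surface measure and Lipschitz maps -/

theorem euclideanHausdorffMeasure_image_le {X Y : Type*} [EMetricSpace X] [MeasurableSpace X]
    [BorelSpace X] [EMetricSpace Y] [MeasurableSpace Y] [BorelSpace Y] {K : NNReal} {f : X → Y}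
    {s : Set X} (h : LipschitzOnWith K f s) (m : ℕ) :
    μHE[m] (f '' s) ≤ (K : ℝ≥0∞) ^ m * μHE[m] s := by
  rw [MeasureTheory.Measure.euclideanHausdorffMeasure_def,
    MeasureTheory.Measure.euclideanHausdorffMeasure_def, MeasureTheory.Measure.smul_apply,
    MeasureTheory.Measure.smul_apply, ENNReal.smul_def, smul_eq_mul, ENNReal.smul_def, smul_eq_mul,
    mul_left_comm]
  gcongr
  simpa using h.hausdorffMeasure_image_le (d := m) (by positivity)

theorem volume_box {m : ℕ} (α β : Fin m → ℝ) :
    MeasureTheory.volume {t : EuclideanSpace ℝ (Fin m) | ∀ i, t i ∈ Set.Icc (α i) (β i)} =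
      ∏ i, ENNReal.ofReal (β i - α i) := by
  have h := (EuclideanSpace.volume_preserving_symm_measurableEquiv_toLp (Fin m)).measure_preimage
    (measurableSet_Icc (a := α) (b := β)).nullMeasurableSet
  rw [Real.volume_Icc_pi] at h
  rw [← h]
  congr 1
  ext t
  simp [Set.mem_Icc, Pi.le_def, forall_and]

/-- Lower bound for the surface measure of the image of a box in a coordinate hyperplane. -/
theorem prod_le_surf_image {m : ℕ} {L : ℝ} (hL : 0 ≤ L) {ψ : Space (m + 1) → Space (m + 1)}
    (c₀ : Fin (m + 1)) (v : ℝ) (α β : Fin (m + 1) → ℝ)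
    {S : Set (Space (m + 1))}
    (hS : ∀ y, y c₀ = v → (∀ c ≠ c₀, y c ∈ Set.Icc (α c) (β c)) → y ∈ S)
    (hlow : ∀ x ∈ S, ∀ y ∈ S, ‖x - y‖ ≤ L * ‖ψ x - ψ y‖) :
    ∏ i, ENNReal.ofReal (β (c₀.succAbove i) - α (c₀.succAbove i)) ≤
      ENNReal.ofReal L ^ m * surf (m + 1) (ψ '' S) := by
  classical
  -- Dropping the coordinate `c₀` after inverting `ψ` is `L`-Lipschitz on `ψ '' S` and covers the
  -- `m`-dimensional box, where the Hausdorff measure is Lebesgue measure.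
  let π : Space (m + 1) → Space m := fun y => WithLp.toLp 2 fun i => y (c₀.succAbove i)
  have hπ : ∀ x y, ‖π x - π y‖ ≤ ‖x - y‖ := by
    intro x y
    rw [EuclideanSpace.norm_eq, EuclideanSpace.norm_eq]
    refine Real.sqrt_le_sqrt ?_
    rw [Fin.sum_univ_succAbove _ c₀]
    exact le_add_of_nonneg_left (by positivity)
  have hlip : LipschitzOnWith L.toNNReal (π ∘ Function.invFunOn ψ S) (ψ '' S) := by
    refine LipschitzOnWith.of_dist_le_mul fun x hx y hy => ?_
    rw [dist_eq_norm, dist_eq_norm, Real.coe_toNNReal L hL]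
    refine (hπ _ _).trans ((hlow _ (Function.invFunOn_mem hx) _ (Function.invFunOn_mem hy)).trans ?_)
    rw [Function.invFunOn_eq hx, Function.invFunOn_eq hy]
  have hinj : Set.InjOn ψ S := by
    intro x hx y hy hxy
    have := hlow x hx y hy
    rw [hxy, sub_self, norm_zero, mul_zero] at this
    exact sub_eq_zero.1 (norm_le_zero_iff.1 this)
  have h := euclideanHausdorffMeasure_image_le hlip m
  have hsub : {t : EuclideanSpace ℝ (Fin m) | ∀ i,
      t i ∈ Set.Icc (α (c₀.succAbove i)) (β (c₀.succAbove i))} ⊆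
      (π ∘ Function.invFunOn ψ S) '' (ψ '' S) := by
    intro t ht
    have hy : WithLp.toLp 2 (c₀.insertNth v t.ofLp : Fin (m + 1) → ℝ) ∈ S := by
      refine hS _ (by simp) fun c hc => ?_
      obtain ⟨i, rfl⟩ := Fin.exists_succAbove_eq hc
      simpa using ht i
    refine ⟨ψ _, Set.mem_image_of_mem _ hy, ?_⟩
    simp only [Function.comp_apply]
    rw [hinj.leftInvOn_invFunOn hy]
    ext i
    simp [π]
  rw [← volume_box (fun i => α (c₀.succAbove i)) (fun i => β (c₀.succAbove i)),
    ← EuclideanSpace.euclideanHausdorffMeasure_eq_volume]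
  exact (MeasureTheory.measure_mono hsub).trans h

/-! ### The inverse inequality on the boundary of a patch -/

namespace Patch

variable {d k : ℕ}

/-- On the closed boundary faces of the elements, the polynomial pieces of a discrete function are
controlled by the `L²` norm of its trace. -/
theorem exists_sq_piece_le (m k : ℕ) {L : ℝ} (hL : 0 < L) : ∃ C : ℝ, 0 ≤ C ∧
    ∀ (P : Patch (m + 1) k), IsOpen P.domain → P.BiLipschitz L →
      ∀ (H : ℝ), 0 < H → (∀ j, P.IsElement j → ∀ c, H ≤ P.edge j c) →
      ∀ (ψ : Space (m + 1) → Space (m + 1)), Continuous ψ →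
      (∀ x ∈ cube (m + 1), ψ x = P.map x) →
      (∀ x ∈ closedCube (m + 1), ∀ y ∈ closedCube (m + 1), ‖x - y‖ ≤ L * ‖ψ x - ψ y‖) →
      frontier P.domain = ψ '' (closedCube (m + 1) \ cube (m + 1)) →
      ∀ (φ s g : Space (m + 1) → ℝ), (∀ x ∈ cube (m + 1), φ (P.map x) = s x) →
      IsTrace 2 P.domain φ g →
      ∀ j, P.IsElement j → ∀ q, IsCoordPoly k q → (∀ x ∈ P.cell j, s x = q x.ofLp) →
      ∀ z ∈ closedCube (m + 1) \ cube (m + 1), z.ofLp ∈ Set.Icc (P.lower j) (P.upper j) →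
        q z.ofLp ^ 2 ≤ C / H ^ m * ∫ x in frontier P.domain, g x ^ 2 ∂surf (m + 1) := by
  obtain ⟨δ, hδ, hbox⟩ := exists_subbox (m + 1) k
  -- The 4 is the square of the factor 2 lost on the sub-box; its `m` edges have length at least `δ
  -- * H`, and `L ^ m` accounts for the distortion of surface measure.
  refine ⟨4 * (L / δ) ^ m, by positivity, ?_⟩
  intro P hU hP H hH hedge ψ hψc hψP hlow hfr φ s g hφs hg j hj q hq hsq z hz hzj
  obtain ⟨c₀, hc₀⟩ : ∃ c₀, z c₀ = 0 ∨ z c₀ = 1 := by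
    by_contra! hcon
    exact hz.2 fun c => ⟨(hz.1 c).1.lt_of_ne' (hcon c).1, (hz.1 c).2.lt_of_ne (hcon c).2⟩
  have hlt : ∀ c, P.lower j c < P.upper j c := fun c => (hj c).2
  -- The element is collapsed in direction `c₀` to the face through `z`, so that the sub-box is
  -- found within the face.
  let a : Fin (m + 1) → ℝ := Function.update (P.lower j) c₀ (z c₀)
  let b : Fin (m + 1) → ℝ := Function.update (P.upper j) c₀ (z c₀)
  have ha : ∀ c ≠ c₀, a c = P.lower j c := fun c hc => by simp [a, hc]
  have hb : ∀ c ≠ c₀, b c = P.upper j c := fun c hc => by simp [b, hc]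
  have ha₀ : a c₀ = z c₀ := by simp [a]
  have hb₀ : b c₀ = z c₀ := by simp [b]
  have hab : a ≤ b := by
    intro c
    rcases eq_or_ne c c₀ with rfl | hc
    · rw [ha₀, hb₀]
    · rw [ha c hc, hb c hc]; exact (hlt c).le
  have hzab : z.ofLp ∈ Set.Icc a b := by
    constructor <;> intro c <;> rcases eq_or_ne c c₀ with rfl | hc
    · rw [ha₀]
    · rw [ha c hc]; exact hzj.1 c
    · rw [hb₀]
    · rw [hb c hc]; exact hzj.2 c
  obtain ⟨α, β, hαβ, hhalf⟩ := hbox q hq a b hab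
  have hltab : ∀ c ≠ c₀, a c < b c := fun c hc => by rw [ha c hc, hb c hc]; exact hlt c
  let S : Set (Space (m + 1)) := {y | y.ofLp ∈ Set.Icc (Function.update α c₀ (z c₀))
    (Function.update β c₀ (z c₀))}
  have hSmem : ∀ y, y ∈ S ↔ y c₀ = z c₀ ∧ ∀ c ≠ c₀, y c ∈ Set.Icc (α c) (β c) := by
    intro y
    constructor
    · intro hy
      refine ⟨le_antisymm (by simpa using hy.2 c₀) (by simpa using hy.1 c₀), fun c hc => ?_⟩
      exact ⟨by simpa [hc] using hy.1 c, by simpa [hc] using hy.2 c⟩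
    · rintro ⟨h0, h1⟩
      constructor <;> intro c <;> rcases eq_or_ne c c₀ with rfl | hc
      · simp [h0]
      · simpa [hc] using (h1 c hc).1
      · simp [h0]
      · simpa [hc] using (h1 c hc).2
  have hSopen : ∀ y ∈ S, ∀ c ≠ c₀, y c ∈ Set.Ioo (P.lower j c) (P.upper j c) := by
    intro y hy c hc
    obtain ⟨h1, h2, -⟩ := hαβ c (hltab c hc)
    have h3 := ((hSmem y).1 hy).2 c hc
    rw [ha c hc] at h1
    rw [hb c hc] at h2
    exact ⟨h1.trans_le h3.1, h3.2.trans_lt h2⟩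
  have hSbd : S ⊆ closedCube (m + 1) \ cube (m + 1) := by
    intro y hy
    have hy₀ := ((hSmem y).1 hy).1
    refine ⟨fun c => ?_, fun hcube => ?_⟩
    · rcases eq_or_ne c c₀ with rfl | hc
      · rw [hy₀]; exact hz.1 c
      · have := hSopen y hy c hc
        exact ⟨((P.knots c).knot_nonneg _).trans this.1.le,
          this.2.le.trans ((P.knots c).knot_le_one (hj c).1)⟩
    · have := hcube c₀
      rw [hy₀] at this
      rcases hc₀ with h | h <;> rw [h] at this <;> linarith [this.1, this.2]
  have hScomp : IsCompact S := isCompact_ofLp_preimage isCompact_Icc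
  have hψS : IsCompact (ψ '' S) := hScomp.image hψc
  have hψSfr : ψ '' S ⊆ frontier P.domain := by
    rw [hfr]; exact Set.image_mono hSbd
  have hval : ∀ᵐ x ∂(surf (m + 1)).restrict (ψ '' S), q z.ofLp ^ 2 / 4 ≤ g x ^ 2 := by
    filter_upwards [MeasureTheory.ae_restrict_of_ae_restrict_of_subset hψSfr hg.2.2,
      MeasureTheory.ae_restrict_mem hψS.measurableSet] with x hlim hx
    obtain ⟨y, hy, rfl⟩ := hx
    have hy₀ := ((hSmem y).1 hy).1
    have hcell := P.eventually_mem_cell hj c₀ (hy₀ ▸ hc₀) (hy₀ ▸ ⟨hzj.1 c₀, hzj.2 c₀⟩) (hSopen y hy)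
    have hqc : Filter.Tendsto (fun w : Space (m + 1) => |q w.ofLp - g (ψ y)|) (nhds y)
        (nhds |q y.ofLp - g (ψ y)|) :=
      ((hq.1.comp (PiLp.continuous_ofLp 2 _)).sub continuous_const).abs.tendsto y
    -- Otherwise `|s - g (ψ y)|` would stay away from zero near `y`, because there `s` is the single
    -- continuous function `q`.
    have hgq : g (ψ y) = q y.ofLp := by
      have : |q y.ofLp - g (ψ y)| ≤ 0 := by
        refine le_of_forall_pos_le_add fun ε hε => ?_
        rw [zero_add, ← sub_nonpos]
        refine P.nonpos_of_trace hL hU hψP hlow (hSbd hy).1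
          (hψSfr (Set.mem_image_of_mem _ hy)) hg.1 hφs hlim ?_
        filter_upwards [hcell, hqc.eventually_const_lt (sub_lt_self _ hε)] with w h1 h2 hw
        rw [hsq w (h1 hw)]
        exact h2.le
      exact (sub_eq_zero.1 (abs_nonpos_iff.1 this)).symm
    have hyab : y.ofLp ∈ Set.Icc a b := by
      constructor <;> intro c <;> rcases eq_or_ne c c₀ with rfl | hc
      · rw [ha₀, hy₀]
      · rw [ha c hc]; exact (hSopen y hy c hc).1.le
      · rw [hb₀, hy₀]
      · rw [hb c hc]; exact (hSopen y hy c hc).2.le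
    have h2 := hhalf _ hyab (fun c hc => ?_) _ hzab
    · rw [hgq, ← sq_abs (q z.ofLp), ← sq_abs (q y.ofLp)]
      nlinarith [abs_nonneg (q z.ofLp), abs_nonneg (q y.ofLp)]
    · rcases eq_or_ne c c₀ with rfl | hne
      · rw [ha₀, hb₀] at hc
        exact absurd hc (lt_irrefl _)
      · exact ((hSmem y).1 hy).2 c hne
  have hint : MeasureTheory.IntegrableOn (fun x => g x ^ 2) (frontier P.domain) (surf (m + 1)) :=
    hg.2.1.integrable_sq
  have hmeas := prod_le_surf_image hL.le c₀ (z c₀) α β (S := S) (ψ := ψ)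
    (fun y h0 h1 => (hSmem y).2 ⟨h0, h1⟩)
    (fun x hx y hy => hlow x (hSbd hx).1 y (hSbd hy).1)
  have hprod : ENNReal.ofReal (δ * H) ^ m ≤
      ∏ i, ENNReal.ofReal (β (c₀.succAbove i) - α (c₀.succAbove i)) := by
    calc ENNReal.ofReal (δ * H) ^ m = ∏ _i : Fin m, ENNReal.ofReal (δ * H) := by simp
      _ ≤ _ := by
        refine Finset.prod_le_prod' fun i _ => ENNReal.ofReal_le_ofReal ?_
        have hne := Fin.succAbove_ne c₀ i
        rw [(hαβ _ (hltab _ hne)).2.2, ha _ hne, hb _ hne]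
        exact mul_le_mul_of_nonneg_left (hedge j hj _) hδ.le
  have hlow2 : ENNReal.ofReal (q z.ofLp ^ 2 / 4) * surf (m + 1) (ψ '' S) ≤
      ENNReal.ofReal (∫ x in frontier P.domain, g x ^ 2 ∂surf (m + 1)) := by
    rw [MeasureTheory.ofReal_integral_eq_lintegral_ofReal hint
      (Filter.Eventually.of_forall fun x => sq_nonneg _), ← MeasureTheory.setLIntegral_const]
    refine le_trans (MeasureTheory.lintegral_mono_ae ?_) (MeasureTheory.lintegral_mono_set hψSfr)
    filter_upwards [hval] with x hx using ENNReal.ofReal_le_ofReal hx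
  set I := ∫ x in frontier P.domain, g x ^ 2 ∂surf (m + 1) with hI
  have hI0 : 0 ≤ I := MeasureTheory.integral_nonneg fun x => sq_nonneg _
  have hfinal : (δ * H) ^ m * (q z.ofLp ^ 2 / 4) ≤ L ^ m * I := by
    have h1 : ENNReal.ofReal (δ * H) ^ m * ENNReal.ofReal (q z.ofLp ^ 2 / 4) ≤
        ENNReal.ofReal L ^ m * ENNReal.ofReal I := by
      refine (mul_le_mul_left (hprod.trans hmeas) _).trans ?_
      rw [mul_assoc, mul_comm (surf _ _)]
      exact mul_le_mul_right hlow2 _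
    rw [← ENNReal.ofReal_pow (by positivity), ← ENNReal.ofReal_pow hL.le,
      ← ENNReal.ofReal_mul (by positivity), ← ENNReal.ofReal_mul (by positivity)] at h1
    exact (ENNReal.ofReal_le_ofReal_iff (by positivity)).1 h1
  rw [mul_pow] at hfinal
  rw [div_pow, mul_div_assoc', div_div, div_mul_eq_mul_div, le_div_iff₀ (by positivity)]
  linarith

/-- The inverse inequality `‖φ‖_{L^∞(∂Ω)} ≤ C H ^ (-(d-1)/2) ‖φ‖_{L²(∂Ω)}` for discrete functions. -/
theorem exists_sq_trace_le (m k : ℕ) {L : ℝ} (hL : 0 < L) : ∃ C : ℝ, 0 ≤ C ∧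
    ∀ (P : Patch (m + 1) k), IsOpen P.domain → P.BiLipschitz L →
      ∀ (H : ℝ), 0 < H → (∀ j, P.IsElement j → ∀ c, H ≤ P.edge j c) →
      ∀ φ, P.IsDiscrete φ → ∀ g, IsTrace 2 P.domain φ g →
      ∀ᵐ x ∂(surf (m + 1)).restrict (frontier P.domain),
        g x ^ 2 ≤ C / H ^ m * ∫ x in frontier P.domain, g x ^ 2 ∂surf (m + 1) := by
  obtain ⟨C, hC0, hC⟩ := exists_sq_piece_le m k hL
  refine ⟨C, hC0, fun P hU hP H hH hedge φ ⟨s, hs, hφs⟩ g hg => ?_⟩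
  obtain ⟨ψ, hψc, hψP, hlow, hfr⟩ := P.exists_extension hP hU
  choose q hq hsq using P.exists_isCoordPoly hs
  set A := C / H ^ m * ∫ x in frontier P.domain, g x ^ 2 ∂surf (m + 1) with hA
  have hA0 : 0 ≤ A := mul_nonneg (by positivity)
    (MeasureTheory.integral_nonneg fun x => sq_nonneg _)
  filter_upwards [hg.2.2, MeasureTheory.ae_restrict_mem isClosed_frontier.measurableSet]
    with x hlim hx
  have hx' := hx
  rw [hfr] at hx'
  obtain ⟨z, hz, rfl⟩ := hx'
  suffices h : |g (ψ z)| ≤ Real.sqrt A by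
    rw [← sq_abs, ← Real.sq_sqrt hA0]
    exact pow_le_pow_left₀ (abs_nonneg _) h 2
  refine le_of_forall_pos_le_add fun ε hε => ?_
  rw [← sub_nonpos]
  refine P.nonpos_of_trace hL hU hψP hlow hz.1 hx hg.1 hφs hlim ?_
  -- Edges and corners need no exclusion: each element whose closure contains `z` satisfies the
  -- bound at `z`, hence nearby by continuity, and every other element stays away from `z`. There
  -- are finitely many elements, so one neighbourhood serves all.
  have hev : ∀ j ∈ {j | P.IsElement j}, ∀ᶠ y in nhds z, y ∈ P.cell j →
      |q j y.ofLp| ≤ Real.sqrt A + ε := by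
    intro j hj
    by_cases hzj : z.ofLp ∈ Set.Icc (P.lower j) (P.upper j)
    · have h1 : |q j z.ofLp| < Real.sqrt A + ε := by
        refine lt_of_le_of_lt (Real.abs_le_sqrt ?_) (lt_add_of_pos_right _ hε)
        exact hC P hU hP H hH hedge ψ hψc hψP hlow hfr φ s g hφs hg j hj (q j) (hq j) (hsq j) z hz
          hzj
      have h2 : Filter.Tendsto (fun w : Space (m + 1) => |q j w.ofLp|) (nhds z)
          (nhds |q j z.ofLp|) :=
        ((hq j).1.comp (PiLp.continuous_ofLp 2 _)).abs.tendsto z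
      filter_upwards [h2.eventually_lt_const h1] with y hy _ using hy.le
    · have hcl : IsClosed ((fun x : Space (m + 1) => x.ofLp) ⁻¹'
          Set.Icc (P.lower j) (P.upper j)) := (isCompact_ofLp_preimage isCompact_Icc).isClosed
      filter_upwards [hcl.isOpen_compl.mem_nhds hzj] with y hy hyc
      exact absurd ⟨fun c => (hyc c).1, fun c => (hyc c).2.le⟩ hy
  filter_upwards [(P.finite_setOf_isElement.eventually_all).2 hev] with y hy hyc
  obtain ⟨j, hj, hyj⟩ := P.exists_cell hyc
  have h1 := hy j hj hyj
  rw [hsq j y hyj]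
  have h2 := abs_sub_abs_le_abs_sub (g (ψ z)) (q j y.ofLp)
  rw [abs_sub_comm] at h2
  linarith

end Patch

/-! ### Hölder inequalities and change of variables -/

/-- Cauchy-Schwarz with the weight `c` split as `√c * √c`, the form in which summands of the dG norm
provide the two factors. -/
theorem mul_integral_abs_mul_abs_le {X : Type*} [MeasurableSpace X] {μ : MeasureTheory.Measure X}
    {f g : X → ℝ} (hf : MeasureTheory.MemLp f 2 μ) (hg : MeasureTheory.MemLp g 2 μ) {c a b : ℝ}
    (hc : 0 ≤ c) (ha : 0 ≤ a) (hb : 0 ≤ b) (hfa : c * ∫ x, f x ^ 2 ∂μ ≤ a ^ 2)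
    (hgb : c * ∫ x, g x ^ 2 ∂μ ≤ b ^ 2) : c * ∫ x, |f x| * |g x| ∂μ ≤ a * b := by
  have h := MeasureTheory.integral_mul_le_Lp_mul_Lq_of_nonneg Real.HolderConjugate.two_two
    (μ := μ) (f := fun x => |f x|) (g := fun x => |g x|)
    (Filter.Eventually.of_forall fun _ => abs_nonneg _)
    (Filter.Eventually.of_forall fun _ => abs_nonneg _)
    (by simpa using hf.norm) (by simpa using hg.norm)
  simp only [Real.rpow_two, sq_abs, ← Real.sqrt_eq_rpow] at h
  calc c * ∫ x, |f x| * |g x| ∂μ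
      ≤ c * (Real.sqrt (∫ x, f x ^ 2 ∂μ) * Real.sqrt (∫ x, g x ^ 2 ∂μ)) :=
        mul_le_mul_of_nonneg_left h hc
    _ = Real.sqrt (c * ∫ x, f x ^ 2 ∂μ) * Real.sqrt (c * ∫ x, g x ^ 2 ∂μ) := by
        rw [Real.sqrt_mul hc, Real.sqrt_mul hc]
        nth_rewrite 1 [← Real.mul_self_sqrt hc]
        ring
    _ ≤ a * b := mul_le_mul (Real.sqrt_le_iff.2 ⟨ha, hfa⟩) (Real.sqrt_le_iff.2 ⟨hb, hgb⟩)
        (Real.sqrt_nonneg _) ha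

/-- Hölder's inequality, with the `L^{p'}` norm interpolated between `L²` and `L^∞`. -/
theorem integral_mul_abs_le_of_sq_le {X : Type*} [MeasurableSpace X]
    {μ : MeasureTheory.Measure X} {p : ℝ} (hp : 1 < p) (hp2 : p ≤ 2) {f g : X → ℝ}
    (hf0 : ∀ x, 0 ≤ f x) (hf : MeasureTheory.MemLp f (ENNReal.ofReal p) μ)
    (hg : MeasureTheory.MemLp g 2 μ) {κ G : ℝ} (hκ : 0 ≤ κ) (hG : 0 ≤ G)
    (hgint : ∫ x, g x ^ 2 ∂μ ≤ G ^ 2) (hbd : ∀ᵐ x ∂μ, g x ^ 2 ≤ κ * G ^ 2) :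
    MeasureTheory.Integrable (fun x => f x * |g x|) μ ∧
      ∫ x, f x * |g x| ∂μ ≤ (∫ x, f x ^ p ∂μ) ^ (1 / p) * (κ ^ (1 / p - 1 / 2) * G) := by
  set q := p.conjExponent with hq
  have hpq : p.HolderConjugate q := Real.HolderConjugate.conjExponent hp
  have hq0 : 0 < q := hpq.symm.pos
  have hqinv : 1 / q = 1 - 1 / p := by
    have := hpq.inv_add_inv_eq_one
    simp only [one_div]; linarith
  have hq2 : 2 ≤ q := by
    have h1 : (1 : ℝ) / 2 ≤ 1 / p := one_div_le_one_div_of_le (by linarith) hp2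
    have h2 : 1 / q ≤ 1 / 2 := by rw [hqinv]; linarith
    exact (one_div_le_one_div hq0 two_pos).1 h2
  -- Write `|g|^q = |g|^(q-2) * g²` and use the uniform bound on the first factor; `q ≥ 2` makes its
  -- exponent nonnegative.
  have hpt : ∀ᵐ x ∂μ, |g x| ^ q ≤ (κ * G ^ 2) ^ ((q - 2) / 2) * g x ^ 2 := by
    filter_upwards [hbd] with x hx
    have h1 : |g x| ^ q = (g x ^ 2) ^ ((q - 2) / 2) * g x ^ 2 := by
      rw [← sq_abs, ← Real.rpow_natCast |g x| 2, ← Real.rpow_mul (abs_nonneg _),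
        ← Real.rpow_add_of_nonneg (abs_nonneg _) (by push_cast; linarith) (by norm_num)]
      congr 1
      push_cast
      ring
    rw [h1]
    exact mul_le_mul_of_nonneg_right
      (Real.rpow_le_rpow (sq_nonneg _) hx (by linarith)) (sq_nonneg _)
  have hintq : MeasureTheory.Integrable (fun x => |g x| ^ q) μ := by
    refine (hg.integrable_sq.const_mul ((κ * G ^ 2) ^ ((q - 2) / 2))).mono'
      (hg.1.aemeasurable.abs.pow_const q).aestronglyMeasurable ?_
    filter_upwards [hpt] with x hx
    rwa [Real.norm_of_nonneg (by positivity)]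
  have hgq : MeasureTheory.MemLp (fun x => |g x|) (ENNReal.ofReal q) μ := by
    rw [← MeasureTheory.integrable_norm_rpow_iff hg.1.aemeasurable.abs.aestronglyMeasurable
      (by simpa using hq0) ENNReal.ofReal_ne_top, ENNReal.toReal_ofReal hq0.le]
    simpa using hintq
  have hI := MeasureTheory.integral_mul_le_Lp_mul_Lq_of_nonneg hpq
    (Filter.Eventually.of_forall hf0) (Filter.Eventually.of_forall fun x => abs_nonneg (g x)) hf hgq
  have hIq : (∫ x, |g x| ^ q ∂μ) ^ (1 / q) ≤ κ ^ (1 / p - 1 / 2) * G := by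
    have h1 : ∫ x, |g x| ^ q ∂μ ≤ κ ^ ((q - 2) / 2) * G ^ q := by
      calc ∫ x, |g x| ^ q ∂μ ≤ ∫ x, (κ * G ^ 2) ^ ((q - 2) / 2) * g x ^ 2 ∂μ :=
            MeasureTheory.integral_mono_ae hintq (hg.integrable_sq.const_mul _) hpt
        _ = (κ * G ^ 2) ^ ((q - 2) / 2) * ∫ x, g x ^ 2 ∂μ :=
            MeasureTheory.integral_const_mul _ _
        _ ≤ (κ * G ^ 2) ^ ((q - 2) / 2) * G ^ 2 :=
            mul_le_mul_of_nonneg_left hgint (by positivity)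
        _ = κ ^ ((q - 2) / 2) * G ^ q := by
            rw [Real.mul_rpow hκ (sq_nonneg _), mul_assoc, ← Real.rpow_natCast G 2,
              ← Real.rpow_mul hG,
              ← Real.rpow_add_of_nonneg hG (by push_cast; linarith) (by norm_num)]
            congr 2
            push_cast
            ring
    calc (∫ x, |g x| ^ q ∂μ) ^ (1 / q) ≤ (κ ^ ((q - 2) / 2) * G ^ q) ^ (1 / q) :=
          Real.rpow_le_rpow (MeasureTheory.integral_nonneg fun x => by positivity) h1
            (by positivity)
      _ = κ ^ (1 / p - 1 / 2) * G := by
          rw [Real.mul_rpow (by positivity) (by positivity), ← Real.rpow_mul hκ,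
            ← Real.rpow_mul hG, mul_one_div_cancel hq0.ne', Real.rpow_one]
          congr 2
          have : (q - 2) / 2 * (1 / q) = 1 / 2 - 1 / q := by field_simp
          rw [this, hqinv]
          ring
  have : (ENNReal.ofReal p).HolderConjugate (ENNReal.ofReal q) := hpq.ennrealOfReal
  refine ⟨hf.integrable_mul hgq, hI.trans (mul_le_mul_of_nonneg_left hIq ?_)⟩
  exact Real.rpow_nonneg (MeasureTheory.integral_nonneg fun x => Real.rpow_nonneg (hf0 x) p) _

theorem memLp_comp_and_integral_comp_le {X E : Type*} [MeasurableSpace X]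
    [NormedAddCommGroup E] {μ ν : MeasureTheory.Measure X} {T : X → X} (hT : AEMeasurable T μ)
    {K : ℝ} (hK : 0 ≤ K) (hmap : μ.map T ≤ ENNReal.ofReal K • ν) {p : ℝ} (hp : 0 < p) {f : X → E}
    (hf : MeasureTheory.MemLp f (ENNReal.ofReal p) ν) :
    MeasureTheory.MemLp (fun x => f (T x)) (ENNReal.ofReal p) μ ∧
      ∫ x, ‖f (T x)‖ ^ p ∂μ ≤ K * ∫ x, ‖f x‖ ^ p ∂ν := by
  have h1 : MeasureTheory.MemLp f (ENNReal.ofReal p) (μ.map T) :=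
    hf.of_measure_le_smul ENNReal.ofReal_ne_top hmap
  have hint : MeasureTheory.Integrable (fun x => ‖f x‖ ^ p) ν := by
    have := hf.integrable_norm_rpow (by simpa using hp) ENNReal.ofReal_ne_top
    rwa [ENNReal.toReal_ofReal hp.le] at this
  refine ⟨h1.comp_of_map hT, ?_⟩
  rw [← MeasureTheory.integral_map (f := fun x => ‖f x‖ ^ p) hT
    (h1.1.norm.aemeasurable.pow_const p).aestronglyMeasurable]
  refine (MeasureTheory.integral_mono_measure hmap
    (Filter.Eventually.of_forall fun x => by positivity)
    (hint.smul_measure ENNReal.ofReal_ne_top)).trans_eq ?_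
  rw [MeasureTheory.integral_smul_measure, ENNReal.toReal_ofReal hK, smul_eq_mul]

/-- The part of `S` sent into `A` is contained in the image of `A ∩ T` under the Lipschitz inverse
`f'`, so its measure grows by at most `K ^ m`. -/
theorem map_restrict_le_smul_restrict {m : ℕ} {S T : Set (Space (m + 1))}
    (hS : MeasurableSet S) {f f' : Space (m + 1) → Space (m + 1)} (hf : ContinuousOn f S)
    (hST : Set.MapsTo f S T) (hinv : ∀ x ∈ S, f' (f x) = x) {K : NNReal}
    (hf' : LipschitzOnWith K f' T) :
    ((surf (m + 1)).restrict S).map f ≤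
      ENNReal.ofReal ((K : ℝ) ^ m) • (surf (m + 1)).restrict T := by
  refine MeasureTheory.Measure.le_iff.2 fun A hA => ?_
  have hfm : AEMeasurable f ((surf (m + 1)).restrict S) := hf.aemeasurable hS
  rw [MeasureTheory.Measure.map_apply_of_aemeasurable hfm hA, MeasureTheory.Measure.smul_apply,
    smul_eq_mul, MeasureTheory.Measure.restrict_apply hA, MeasureTheory.Measure.restrict_apply' hS]
  have hsub : f ⁻¹' A ∩ S ⊆ f' '' (A ∩ T) := fun x hx =>
    ⟨f x, ⟨hx.1, hST hx.2⟩, hinv x hx.2⟩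
  refine (MeasureTheory.measure_mono hsub).trans ?_
  have := euclideanHausdorffMeasure_image_le (hf'.mono (Set.inter_subset_right (s := A))) m
  rw [ENNReal.ofReal_pow K.coe_nonneg, ENNReal.ofReal_coe_nnreal]
  exact this

/-! ### Traces, weak gradients and normals -/

theorem memLp_weakGrad {d : ℕ} (U : Set (Space d)) (f : Space d → ℝ) :
    MeasureTheory.MemLp (weakGrad U f) 2 (MeasureTheory.volume.restrict U) := by
  unfold weakGrad
  split_ifs with h
  · exact h.choose_spec.2.1
  · exact MeasureTheory.MemLp.zero

/-- The default value 0 satisfies every bound needed below, so integrability and estimates hold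
whether or not a trace exists. -/
theorem isTrace_trace_or_eq_zero {d : ℕ} {F : Type*} [NormedAddCommGroup F] (q : ℝ≥0∞)
    (U : Set (Space d)) (w : Space d → F) : IsTrace q U w (trace q U w) ∨ trace q U w = 0 := by
  unfold trace
  split_ifs with h
  · exact Or.inl h.choose_spec
  · exact Or.inr rfl

theorem memLp_trace {d : ℕ} {F : Type*} [NormedAddCommGroup F] (q : ℝ≥0∞) (U : Set (Space d))
    (w : Space d → F) : MeasureTheory.MemLp (trace q U w) q ((surf d).restrict (frontier U)) := by
  rcases isTrace_trace_or_eq_zero q U w with h | h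
  · exact h.2.1
  · rw [h]; exact MeasureTheory.MemLp.zero

theorem norm_outerNormal_le_one {d : ℕ} (U : Set (Space d)) (x : Space d) :
    ‖outerNormal U x‖ ≤ 1 := by
  unfold outerNormal
  split_ifs with h
  · exact h.choose_spec.1.le
  · simp

/-! ### Mesh sizes -/

namespace Patch

variable {d k : ℕ}

theorem element_subset_closedCube (P : Patch d k) {j : Fin d → ℕ} (hj : P.IsElement j) :
    P.element j ⊆ closedCube d := fun _ hx c =>
  ⟨((P.knots c).knot_nonneg _).trans (hx c).1.le,
    (hx c).2.le.trans ((P.knots c).knot_le_one (hj c).1)⟩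

theorem diam_element_le (P : Patch d k) {j : Fin d → ℕ} (hj : P.IsElement j) :
    Metric.diam (P.element j) ≤ Metric.diam (closedCube d) :=
  Metric.diam_mono (P.element_subset_closedCube hj) (isCompact_closedCube d).isBounded

theorem diam_element_le_meshSize (P : Patch d k) {j : Fin d → ℕ} (hj : P.IsElement j) :
    Metric.diam (P.element j) ≤ P.meshSize := by
  refine le_csSup ⟨Metric.diam (closedCube d), ?_⟩ ⟨j, hj, rfl⟩
  rintro _ ⟨i, hi, rfl⟩
  exact P.diam_element_le hi

theorem exists_isElement (P : Patch d k) : ∃ j, P.IsElement j := by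
  obtain ⟨j, hj, -⟩ := P.exists_cell (x := WithLp.toLp 2 fun _ => (1 / 2 : ℝ))
    (fun c => by constructor <;> norm_num)
  exact ⟨j, hj⟩

theorem meshSize_le_of_forall (P : Patch d k) {r : ℝ}
    (h : ∀ j, P.IsElement j → Metric.diam (P.element j) ≤ r) : P.meshSize ≤ r := by
  obtain ⟨j, hj⟩ := P.exists_isElement
  refine csSup_le ⟨_, j, hj, rfl⟩ ?_
  rintro _ ⟨i, hi, rfl⟩
  exact h i hi

theorem meshSize_pos (hd : 0 < d) (P : Patch d k) : 0 < P.meshSize := by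
  obtain ⟨j, hj⟩ := P.exists_isElement
  refine lt_of_lt_of_le ?_ (P.diam_element_le_meshSize hj)
  have hlt : ∀ c, P.lower j c < P.upper j c := fun c => (hj c).2
  have hmem : ∀ t : ℝ, 0 < t → t < 1 → WithLp.toLp 2 (fun c =>
      P.lower j c + t * (P.upper j c - P.lower j c)) ∈ P.element j := by
    intro t h0 h1 c
    have := sub_pos.2 (hlt c)
    change P.lower j c < P.lower j c + _ ∧ P.lower j c + _ < P.upper j c
    constructor <;> nlinarith
  -- Two points on the diagonal of the element are compared; `0 < d` supplies a coordinate in which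
  -- they differ.
  have h := Metric.dist_le_diam_of_mem
    ((isCompact_closedCube d).isBounded.subset (P.element_subset_closedCube hj))
    (hmem (1 / 2) (by norm_num) (by norm_num)) (hmem (1 / 4) (by norm_num) (by norm_num))
  refine lt_of_lt_of_le ?_ h
  rw [dist_pos]
  intro heq
  have h2 := congrArg (fun y : Space d => y ⟨0, hd⟩) heq
  have h3 := hlt ⟨0, hd⟩
  dsimp only at h2
  linarith

theorem meshSize_le_edge (P : Patch d k) {θ : ℝ} (hθ : 0 ≤ θ) (hP : P.QuasiUniform θ)
    {j : Fin d → ℕ} (hj : P.IsElement j) (c : Fin d) : P.meshSize ≤ θ ^ 2 * P.edge j c := by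
  refine P.meshSize_le_of_forall fun i hi => (hP.1 i j hi hj).trans ?_
  rw [sq, mul_assoc]
  exact mul_le_mul_of_nonneg_left (hP.2 j hj c) hθ

end Patch

/-! ### Geometry of the decomposition -/

namespace GapDecomposition

variable {d k : ℕ}

theorem h_pos (hd : 0 < d) (D : GapDecomposition d k) : 0 < D.h :=
  lt_max_of_lt_left ((D.patch 0).meshSize_pos hd)

theorem h_le_diam (D : GapDecomposition d k) : D.h ≤ Metric.diam (closedCube d) :=
  max_le ((D.patch 0).meshSize_le_of_forall fun _ => (D.patch 0).diam_element_le)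
    ((D.patch 1).meshSize_le_of_forall fun _ => (D.patch 1).diam_element_le)

/-- One factor `θ` compares the two patches, one the elements of a patch, and one the diameter of an
element with its edges. -/
theorem Regular.h_le_edge {D : GapDecomposition d k} {L θ M lam : ℝ}
    (hD : D.Regular L θ M lam) (hθ : 0 ≤ θ) (i : Fin 2) {j : Fin d → ℕ}
    (hj : (D.patch i).IsElement j) (c : Fin d) : D.h ≤ θ ^ 3 * (D.patch i).edge j c := by
  have h1 := (D.patch i).meshSize_le_edge hθ (hD.quasiUniform i) hj c
  calc D.h ≤ θ * (D.patch i).meshSize := max_le (hD.comparable 0 i) (hD.comparable 1 i)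
    _ ≤ θ * (θ ^ 2 * (D.patch i).edge j c) := mul_le_mul_of_nonneg_left h1 hθ
    _ = θ ^ 3 * (D.patch i).edge j c := by ring

theorem isCompact_leftFace (D : GapDecomposition d k) : IsCompact D.leftFace := by
  refine Metric.isCompact_of_isClosed_isBounded (isClosed_closure.inter isClosed_closure) ?_
  exact (D.isBounded_Ω.subset D.left_subset).closure.subset Set.inter_subset_left

/-- An open set disjoint from `Ω₂` is also disjoint from its closure, so the face contains no
interior point of the left patch. -/
theorem leftFace_subset_frontier (D : GapDecomposition d k) :
    D.leftFace ⊆ frontier (D.sub 0) := by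
  intro x hx
  refine ⟨hx.1, fun hint => ?_⟩
  have hdisj : Disjoint (D.sub 0) (closure D.Ω₂) :=
    D.disjoint_left_Ω₂.closure_right (D.isOpen_patch 0)
  exact Set.disjoint_left.1 hdisj (interior_subset hint) hx.2

theorem face_subset_frontier (D : GapDecomposition d k) (i : Fin 2) :
    D.face i ⊆ frontier (D.sub i) := by
  fin_cases i
  · exact D.leftFace_subset_frontier
  · exact D.right_face

theorem frontier_subset (D : GapDecomposition d k) (i : Fin 2) :
    frontier (D.sub i) ⊆ D.outer i ∪ D.face i := by
  intro x hx
  have h : x ∈ frontier D.Ω ∪ D.face i := by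
    fin_cases i
    · exact D.frontier_left hx
    · exact D.frontier_right hx
  exact h.imp (fun h => ⟨hx, h⟩) id

theorem mapsTo_opp (D : GapDecomposition d k) (i : Fin 2) :
    Set.MapsTo (D.opp i) (D.face i) (D.face (1 - i)) := by
  fin_cases i
  · exact fun x hx => Set.mem_image_of_mem _ hx
  · rintro _ ⟨x, hx, rfl⟩
    change D.toLeft (D.toRight x) ∈ D.leftFace
    rwa [D.toLeft_toRight hx]

theorem opp_opp (D : GapDecomposition d k) (i : Fin 2) {x : Space d} (hx : x ∈ D.face i) :
    D.opp (1 - i) (D.opp i x) = x := by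
  fin_cases i
  · exact D.toLeft_toRight hx
  · obtain ⟨y, hy, rfl⟩ := hx
    change D.toRight (D.toLeft (D.toRight y)) = D.toRight y
    rw [D.toLeft_toRight hy]

/-- The graph map has Lipschitz constant at most `1 + d_g * M`, and `d_g ≤ h ^ lam` with `h` bounded
by the diameter of the unit cube. The map back is an orthogonal projection, hence nonexpansive. -/
theorem exists_lipschitzOnWith_opp (d : ℕ) {M lam : ℝ} (hM : 0 ≤ M) (hlam : 0 ≤ lam) :
    ∃ K : NNReal, ∀ {k : ℕ} (D : GapDecomposition d k) {L θ : ℝ}, 0 < d → D.Regular L θ M lam →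
      ∀ i, LipschitzOnWith K (D.opp i) (D.face i) := by
  set R : ℝ := Metric.diam (closedCube d) ^ lam with hR
  have hR0 : 0 ≤ R := Real.rpow_nonneg Metric.diam_nonneg _
  refine ⟨⟨1 + R * M, by positivity⟩, fun {k} D L θ hd hD i => ?_⟩
  refine LipschitzOnWith.of_dist_le_mul fun x hx y hy => ?_
  rw [dist_eq_norm, dist_eq_norm]
  change _ ≤ (1 + R * M) * ‖x - y‖
  fin_cases i
  · change ‖D.toRight x - D.toRight y‖ ≤ _
    have h1 : D.toRight x - D.toRight y = (x - y) + (D.dg * (D.ζ x - D.ζ y)) • D.ν := by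
      simp only [toRight]
      module
    have h2 : D.dg ≤ R := hD.gap_le.trans
      (Real.rpow_le_rpow (D.h_pos hd).le D.h_le_diam hlam)
    rw [h1]
    refine (norm_add_le _ _).trans ?_
    rw [norm_smul, D.norm_ν, mul_one, Real.norm_eq_abs, abs_mul, abs_of_pos D.dg_pos, add_mul,
      one_mul, mul_assoc]
    gcongr
    exact hD.lipschitz x hx y hy
  · change ‖D.toLeft x - D.toLeft y‖ ≤ _
    have h1 : D.toLeft x - D.toLeft y = (x - y) - (inner ℝ D.ν (x - y)) • D.ν := by
      simp only [toLeft, inner_sub_right]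
      module
    have h2 : ‖D.toLeft x - D.toLeft y‖ ^ 2 ≤ ‖x - y‖ ^ 2 := by
      rw [h1, norm_sub_sq_real, norm_smul, D.norm_ν, inner_smul_right, real_inner_comm,
        Real.norm_eq_abs, mul_one, sq_abs]
      nlinarith [sq_nonneg (inner ℝ D.ν (x - y))]
    refine (abs_le_of_sq_le_sq' h2 (norm_nonneg _)).2.trans ?_
    nlinarith [norm_nonneg (x - y), mul_nonneg hR0 hM]

theorem Regular.isCompact_face {D : GapDecomposition d k} {L θ M lam : ℝ}
    (hD : D.Regular L θ M lam) (hM : 0 ≤ M) (hlam : 0 ≤ lam) (hd : 0 < d) (i : Fin 2) :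
    IsCompact (D.face i) := by
  fin_cases i
  · exact D.isCompact_leftFace
  · obtain ⟨K, hK⟩ := exists_lipschitzOnWith_opp d hM hlam
    exact D.isCompact_leftFace.image_of_continuousOn (hK D hd hD 0).continuousOn

/-! ### The terms of the norm -/

theorem avgRho_pos {ρ : Fin 2 → ℝ} (hρ : ∀ i, 0 < ρ i) (i : Fin 2) : 0 < avgRho ρ i :=
  half_pos (add_pos (hρ i) (hρ 1))

theorem dG_terms_le (D : GapDecomposition d k) (hd : 0 < d) {ρ : Fin 2 → ℝ} (hρ : ∀ i, 0 < ρ i)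
    (u : Space d → ℝ) (i : Fin 2) :
    ρ i * (∫ x in D.sub i, ‖D.grad u i x‖ ^ 2) ≤ D.dG ρ u ^ 2 ∧
    ρ i / D.h * (∫ x in D.outer i, (D.bval u i x) ^ 2 ∂(surf d)) ≤ D.dG ρ u ^ 2 ∧
    avgRho ρ i / D.h * (∫ x in D.face i, (D.bval u i x) ^ 2 ∂(surf d)) ≤ D.dG ρ u ^ 2 := by
  have hh := D.h_pos hd
  have h1 : ∀ i, 0 ≤ ρ i * (∫ x in D.sub i, ‖D.grad u i x‖ ^ 2) := fun i =>
    mul_nonneg (hρ i).le (MeasureTheory.integral_nonneg fun x => sq_nonneg _)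
  have h2 : ∀ i, 0 ≤ ρ i / D.h * (∫ x in D.outer i, (D.bval u i x) ^ 2 ∂(surf d)) := fun i =>
    mul_nonneg (div_pos (hρ i) hh).le (MeasureTheory.integral_nonneg fun x => sq_nonneg _)
  have h3 : ∀ i, 0 ≤ avgRho ρ i / D.h * (∫ x in D.face i, (D.bval u i x) ^ 2 ∂(surf d)) :=
    fun i => mul_nonneg (div_pos (avgRho_pos hρ i) hh).le
      (MeasureTheory.integral_nonneg fun x => sq_nonneg _)
  have hsum := Finset.single_le_sum (f := fun i =>
    ρ i * (∫ x in D.sub i, ‖D.grad u i x‖ ^ 2) +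
      ρ i / D.h * (∫ x in D.outer i, (D.bval u i x) ^ 2 ∂(surf d)) +
      avgRho ρ i / D.h * (∫ x in D.face i, (D.bval u i x) ^ 2 ∂(surf d)))
    (fun i _ => add_nonneg (add_nonneg (h1 i) (h2 i)) (h3 i)) (Finset.mem_univ i)
  have hsq : D.dG ρ u ^ 2 = _ :=
    Real.sq_sqrt (Finset.sum_nonneg fun i _ => add_nonneg (add_nonneg (h1 i) (h2 i)) (h3 i))
  rw [hsq]
  have a1 := h1 i
  have a2 := h2 i
  have a3 := h3 i
  refine ⟨?_, ?_, ?_⟩ <;> linarith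

theorem dG_nonneg (D : GapDecomposition d k) (ρ : Fin 2 → ℝ) (u : Space d → ℝ) :
    0 ≤ D.dG ρ u := Real.sqrt_nonneg _

theorem memLp_bval (D : GapDecomposition d k) (u : Space d → ℝ) (i : Fin 2) {S : Set (Space d)}
    (hS : S ⊆ frontier (D.sub i)) :
    MeasureTheory.MemLp (D.bval u i) 2 ((surf d).restrict S) :=
  (memLp_trace 2 (D.sub i) u).mono_measure (MeasureTheory.Measure.restrict_mono_set _ hS)

theorem memLp_bgrad (D : GapDecomposition d k) (p : ℝ) (u : Space d → ℝ) (i : Fin 2)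
    {S : Set (Space d)} (hS : S ⊆ frontier (D.sub i)) :
    MeasureTheory.MemLp (D.bgrad p u i) (ENNReal.ofReal p) ((surf d).restrict S) :=
  (memLp_trace (ENNReal.ofReal p) (D.sub i) (D.grad u i)).mono_measure
    (MeasureTheory.Measure.restrict_mono_set _ hS)

theorem outer_subset_frontier (D : GapDecomposition d k) (i : Fin 2) :
    D.outer i ⊆ frontier (D.sub i) := Set.inter_subset_left

/-- The outer part and the face cover the boundary of the patch, and both carry a weight of order `1
/ h` in the dG norm. They may overlap, so the part outside `D.outer i` is only estimated by the
face. -/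
theorem integral_bval_sq_le (D : GapDecomposition d k) (hd : 0 < d) {ρ : Fin 2 → ℝ}
    (hρ : ∀ i, 0 < ρ i) (u : Space d → ℝ) (i : Fin 2) :
    ∫ x in frontier (D.sub i), D.bval u i x ^ 2 ∂(surf d) ≤
      D.h * (1 / ρ i + 1 / avgRho ρ i) * D.dG ρ u ^ 2 := by
  have hh := D.h_pos hd
  obtain ⟨-, h2, h3⟩ := D.dG_terms_le hd hρ u i
  have hav := avgRho_pos hρ i
  have hi := hρ i
  rw [div_mul_eq_mul_div, div_le_iff₀ hh] at h2 h3
  have hmeas : MeasurableSet (D.outer i) :=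
    (isClosed_frontier.inter isClosed_frontier).measurableSet
  have hint : MeasureTheory.IntegrableOn (fun x => D.bval u i x ^ 2) (frontier (D.sub i))
      (surf d) := (D.memLp_bval u i subset_rfl).integrable_sq
  have hintf : MeasureTheory.IntegrableOn (fun x => D.bval u i x ^ 2) (D.face i) (surf d) :=
    (D.memLp_bval u i (D.face_subset_frontier i)).integrable_sq
  have hsplit := MeasureTheory.integral_inter_add_sdiff hmeas hint
  have hinter : frontier (D.sub i) ∩ D.outer i = D.outer i :=
    Set.inter_eq_right.2 (D.outer_subset_frontier i)
  have hface : ∫ x in frontier (D.sub i) \ D.outer i, D.bval u i x ^ 2 ∂(surf d) ≤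
      ∫ x in D.face i, D.bval u i x ^ 2 ∂(surf d) := by
    refine MeasureTheory.setIntegral_mono_set hintf
      (Filter.Eventually.of_forall fun x => sq_nonneg _) (LE.le.eventuallyLE ?_)
    intro x hx
    exact (D.frontier_subset i hx.1).resolve_left hx.2
  rw [hinter] at hsplit
  have e2 : ∫ x in D.outer i, D.bval u i x ^ 2 ∂(surf d) ≤ D.dG ρ u ^ 2 * D.h / ρ i := by
    rw [le_div_iff₀ hi]; linarith
  have e3 : ∫ x in D.face i, D.bval u i x ^ 2 ∂(surf d) ≤ D.dG ρ u ^ 2 * D.h / avgRho ρ i := by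
    rw [le_div_iff₀ hav]; linarith
  rw [← hsplit]
  refine (add_le_add e2 (hface.trans e3)).trans_eq ?_
  field_simp

/-- The pairing of an `L^p` function on the boundary with a discrete function. -/
theorem exists_integral_mul_bval_le (m k : ℕ) {p L θ M lam : ℝ} {ρ : Fin 2 → ℝ} (hp : 1 < p)
    (hp2 : p ≤ 2) (hθ : 0 < θ) (hL : 0 < L) (hρ : ∀ i, 0 < ρ i) : ∃ C : ℝ, 0 ≤ C ∧
      ∀ D : GapDecomposition (m + 1) k, D.Regular L θ M lam → ∀ φ ∈ D.Vh, ∀ i,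
        ∀ S ⊆ frontier (D.sub i), ∀ f : Space (m + 1) → ℝ, (∀ x, 0 ≤ f x) →
          MeasureTheory.MemLp f (ENNReal.ofReal p) ((surf (m + 1)).restrict S) →
          MeasureTheory.IntegrableOn (fun x => f x * |D.bval φ i x|) S (surf (m + 1)) ∧
          ∫ x in S, f x * |D.bval φ i x| ∂surf (m + 1) ≤
            (∫ x in S, f x ^ p ∂surf (m + 1)) ^ (1 / p) *
              (C * (D.h ^ ((1 + ((m + 1 : ℕ) : ℝ) * (p - 2) / 2) / p) * D.dG ρ φ)) := by
  obtain ⟨C, hC0, hC⟩ := Patch.exists_sq_trace_le m k hL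
  have hav := avgRho_pos hρ
  set e : ℝ := 1 / p - 1 / 2 with he
  have he0 : 0 ≤ e := sub_nonneg.2 (one_div_le_one_div_of_le (by linarith) hp2)
  -- Summing over both patches makes the constant independent of `i`.
  set r : ℝ := ∑ i, (1 / ρ i + 1 / avgRho ρ i) with hr
  have hrpos : ∀ i, 0 ≤ 1 / ρ i + 1 / avgRho ρ i := fun i => by
    have := hρ i
    have := hav i
    positivity
  have hr0 : 0 ≤ r := Finset.sum_nonneg fun i _ => hrpos i
  refine ⟨(C * (θ ^ 3) ^ m) ^ e * Real.sqrt r, by positivity, ?_⟩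
  intro D hD φ hφ i S hS f hf0 hf
  have hh := D.h_pos m.succ_pos
  set H : ℝ := D.h / θ ^ 3 with hH
  have hH0 : 0 < H := by positivity
  have hedge : ∀ j, (D.patch i).IsElement j → ∀ c, H ≤ (D.patch i).edge j c := fun j hj c => by
    rw [hH, div_le_iff₀ (by positivity), mul_comm]
    exact hD.h_le_edge hθ.le i hj c
  set κ : ℝ := C / H ^ m with hκ
  have hκ0 : 0 ≤ κ := by positivity
  set G : ℝ := Real.sqrt (D.h * r) * D.dG ρ φ with hG
  have hG0 : 0 ≤ G := mul_nonneg (Real.sqrt_nonneg _) (D.dG_nonneg ρ φ)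
  have hGint : ∫ x in frontier (D.sub i), D.bval φ i x ^ 2 ∂surf (m + 1) ≤ G ^ 2 := by
    refine (D.integral_bval_sq_le m.succ_pos hρ φ i).trans ?_
    rw [hG, mul_pow, Real.sq_sqrt (by positivity)]
    gcongr
    exact Finset.single_le_sum (f := fun i => 1 / ρ i + 1 / avgRho ρ i)
      (fun i _ => hrpos i) (Finset.mem_univ i)
  have hbd : ∀ᵐ x ∂(surf (m + 1)).restrict (frontier (D.sub i)),
      D.bval φ i x ^ 2 ≤ κ * G ^ 2 := by
    rcases isTrace_trace_or_eq_zero 2 (D.sub i) φ with h | h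
    · filter_upwards [hC (D.patch i) (D.isOpen_patch i) (hD.biLipschitz i) H hH0 hedge φ (hφ i) _ h]
        with x hx
      exact hx.trans (mul_le_mul_of_nonneg_left hGint hκ0)
    · refine Filter.Eventually.of_forall fun x => ?_
      have : D.bval φ i x = 0 := congrFun h x
      rw [this, zero_pow two_ne_zero]
      positivity
  have hSint : ∫ x in S, D.bval φ i x ^ 2 ∂surf (m + 1) ≤ G ^ 2 :=
    (MeasureTheory.setIntegral_mono_set (D.memLp_bval φ i subset_rfl).integrable_sq
      (Filter.Eventually.of_forall fun x => sq_nonneg _) hS.eventuallyLE).trans hGint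
  obtain ⟨h1, h2⟩ := integral_mul_abs_le_of_sq_le hp hp2 hf0 hf (D.memLp_bval φ i hS) hκ0 hG0 hSint
    (MeasureTheory.ae_restrict_of_ae_restrict_of_subset hS hbd)
  refine ⟨h1, h2.trans_eq ?_⟩
  congr 1
  have hκe : κ ^ e = (C * (θ ^ 3) ^ m) ^ e * D.h ^ (-(m * e)) := by
    have : κ = C * (θ ^ 3) ^ m * (D.h ^ m)⁻¹ := by
      rw [hκ, hH, div_pow, div_div_eq_mul_div, div_eq_mul_inv]
    rw [this, Real.mul_rpow (by positivity) (by positivity), Real.inv_rpow (by positivity),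
      ← Real.rpow_natCast D.h m, ← Real.rpow_mul hh.le, ← Real.rpow_neg hh.le]
  -- Here `-(m * e)` comes from the inverse inequality with `m = d - 1`, and `1 / 2` from the factor
  -- `h` in the bound for the squared `L²` norm.
  have hexp : (1 + ((m + 1 : ℕ) : ℝ) * (p - 2) / 2) / p = -(m * e) + 1 / 2 := by
    rw [he]
    push_cast
    field_simp
    ring
  rw [hκe, hG, Real.sqrt_mul hh.le, hexp, Real.rpow_add hh, Real.sqrt_eq_rpow D.h]
  ring

theorem Regular.memLp_comp_opp {m k : ℕ} {D : GapDecomposition (m + 1) k} {L θ M lam : ℝ} {K : NNReal}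
    (hD : D.Regular L θ M lam) (hM : 0 ≤ M) (hlam : 0 ≤ lam)
    (hK : ∀ i, LipschitzOnWith K (D.opp i) (D.face i)) {E : Type*} [NormedAddCommGroup E]
    (i : Fin 2) {p : ℝ} (hp : 0 < p) {f : Space (m + 1) → E}
    (hf : MeasureTheory.MemLp f (ENNReal.ofReal p) ((surf (m + 1)).restrict (D.face (1 - i)))) :
    MeasureTheory.MemLp (fun x => f (D.opp i x)) (ENNReal.ofReal p)
        ((surf (m + 1)).restrict (D.face i)) ∧
      ∫ x in D.face i, ‖f (D.opp i x)‖ ^ p ∂surf (m + 1) ≤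
        (K : ℝ) ^ m * ∫ x in D.face (1 - i), ‖f x‖ ^ p ∂surf (m + 1) := by
  have hmeas := (hD.isCompact_face hM hlam m.succ_pos i).isClosed.measurableSet
  have hcont := (hK i).continuousOn
  exact memLp_comp_and_integral_comp_le (hcont.aemeasurable hmeas) (by positivity)
    (map_restrict_le_smul_restrict hmeas hcont (D.mapsTo_opp i)
      (fun x hx => D.opp_opp i hx) (hK (1 - i))) hp hf

end GapDecomposition

/-! ### Boundedness of the form -/

namespace GapDecomposition

variable {d k : ℕ}

theorem abs_integral_grad_le (D : GapDecomposition d k) (hd : 0 < d) {ρ : Fin 2 → ℝ}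
    (hρ : ∀ i, 0 < ρ i) (u φ : Space d → ℝ) (i : Fin 2) :
    |∫ x in D.sub i, ρ i * inner ℝ (D.grad u i x) (D.grad φ i x)| ≤ D.dG ρ u * D.dG ρ φ := by
  have hu : MeasureTheory.MemLp (fun x => ‖D.grad u i x‖) 2
      (MeasureTheory.volume.restrict (D.sub i)) := (memLp_weakGrad (D.sub i) u).norm
  have hφ : MeasureTheory.MemLp (fun x => ‖D.grad φ i x‖) 2
      (MeasureTheory.volume.restrict (D.sub i)) := (memLp_weakGrad (D.sub i) φ).norm
  have h := mul_integral_abs_mul_abs_le hu hφ (hρ i).le (D.dG_nonneg ρ u) (D.dG_nonneg ρ φ)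
    (D.dG_terms_le hd hρ u i).1 (D.dG_terms_le hd hρ φ i).1
  simp only [abs_norm] at h
  refine le_trans ?_ h
  rw [← MeasureTheory.integral_const_mul, ← Real.norm_eq_abs]
  refine MeasureTheory.norm_integral_le_of_norm_le ((hu.integrable_mul hφ).const_mul _)
    (Filter.Eventually.of_forall fun x => ?_)
  rw [norm_mul, Real.norm_of_nonneg (hρ i).le]
  exact mul_le_mul_of_nonneg_left (norm_inner_le_norm _ _) (hρ i).le

theorem abs_integral_outer_le (D : GapDecomposition d k) (hd : 0 < d) {ρ : Fin 2 → ℝ}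
    (hρ : ∀ i, 0 < ρ i) (u φ : Space d → ℝ) (i : Fin 2) :
    |ρ i / D.h * ∫ x in D.outer i, D.bval u i x * D.bval φ i x ∂(surf d)| ≤
      D.dG ρ u * D.dG ρ φ := by
  have hc : 0 ≤ ρ i / D.h := div_nonneg (hρ i).le (D.h_pos hd).le
  have h := mul_integral_abs_mul_abs_le (D.memLp_bval u i (D.outer_subset_frontier i))
    (D.memLp_bval φ i (D.outer_subset_frontier i)) hc (D.dG_nonneg ρ u) (D.dG_nonneg ρ φ)
    (D.dG_terms_le hd hρ u i).2.1 (D.dG_terms_le hd hρ φ i).2.1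
  refine le_trans ?_ h
  rw [abs_mul, abs_of_nonneg hc]
  refine mul_le_mul_of_nonneg_left ?_ hc
  simp only [← abs_mul]
  exact MeasureTheory.abs_integral_le_integral_abs

theorem norm_face_integrand_le {E : Type*} [NormedAddCommGroup E] [InnerProductSpace ℝ E]
    {r r' c s t φ : ℝ} {a b n : E} (hr : 0 ≤ r) (hr' : 0 ≤ r') (hc : 0 ≤ c) (hn : ‖n‖ ≤ 1) :
    ‖inner ℝ (r • a + r' • b) n * φ - c * (s - t) * φ‖ ≤
      r * (‖a‖ * |φ|) + r' * (‖b‖ * |φ|) + c * (|s| * |φ|) + c * (|t| * |φ|) := by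
  have h1 : ‖inner ℝ (r • a + r' • b) n‖ ≤ r * ‖a‖ + r' * ‖b‖ := by
    refine (norm_inner_le_norm _ _).trans ((mul_le_of_le_one_right (norm_nonneg _) hn).trans ?_)
    refine (norm_add_le _ _).trans_eq ?_
    rw [norm_smul, norm_smul, Real.norm_of_nonneg hr, Real.norm_of_nonneg hr']
  have h2 : ‖c * (s - t)‖ ≤ c * (|s| + |t|) := by
    rw [norm_mul, Real.norm_of_nonneg hc]
    exact mul_le_mul_of_nonneg_left (abs_sub _ _) hc
  refine (norm_sub_le _ _).trans ?_
  rw [norm_mul, norm_mul, Real.norm_eq_abs φ]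
  have h3 := mul_le_mul_of_nonneg_right h1 (abs_nonneg φ)
  have h4 := mul_le_mul_of_nonneg_right h2 (abs_nonneg φ)
  linarith

theorem surfNorm_nonneg {d : ℕ} {F : Type*} [NormedAddCommGroup F] (p : ℝ) (S : Set (Space d))
    (g : Space d → F) : 0 ≤ surfNorm p S g :=
  Real.rpow_nonneg (MeasureTheory.integral_nonneg fun x => by positivity) _

theorem surfNorm_bgrad_mono (D : GapDecomposition d k) {p : ℝ} (hp : 0 < p) (u : Space d → ℝ)
    (i : Fin 2) {S : Set (Space d)} (hS : S ⊆ frontier (D.sub i)) :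
    surfNorm p S (D.bgrad p u i) ≤ surfNorm p (frontier (D.sub i)) (D.bgrad p u i) := by
  refine Real.rpow_le_rpow (MeasureTheory.integral_nonneg fun x => by positivity) ?_
    (by positivity)
  refine MeasureTheory.setIntegral_mono_set ?_
    (Filter.Eventually.of_forall fun x => by positivity) hS.eventuallyLE
  have := (D.memLp_bgrad p u i subset_rfl).integrable_norm_rpow (by simpa using hp)
    ENNReal.ofReal_ne_top
  rwa [ENNReal.toReal_ofReal hp.le] at this

/-- The bound for the boundary terms of `B`, in terms of a common bound `W` for the broken norm
and the scaled traces of the gradients. -/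
theorem exists_abs_boundary_terms_le (m k : ℕ) {p L θ M lam : ℝ} {ρ : Fin 2 → ℝ} (hp : 1 < p)
    (hp2 : p ≤ 2) (hlam : 0 ≤ lam) (hθ : 0 < θ) (hL : 0 < L) (hM : 0 ≤ M) (hρ : ∀ i, 0 < ρ i)
    (i : Fin 2) : ∃ C : ℝ, 0 ≤ C ∧
      ∀ D : GapDecomposition (m + 1) k, D.Regular L θ M lam →
        ∀ (u : Space (m + 1) → ℝ), ∀ φ ∈ D.Vh, ∀ W : ℝ, D.dG ρ u ≤ W →
          (∀ j, D.h ^ ((1 + ((m + 1 : ℕ) : ℝ) * (p - 2) / 2) / p) *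
            surfNorm p (frontier (D.sub j)) (D.bgrad p u j) ≤ W) →
          |∫ x in D.outer i, ρ i * inner ℝ (D.bgrad p u i x) (outerNormal (D.sub i) x) *
              D.bval φ i x ∂(surf (m + 1))| ≤ C * (W * D.dG ρ φ) ∧
          |∫ x in D.face i, (inner ℝ ((ρ i / 2) • D.bgrad p u i x +
                (ρ (1 - i) / 2) • D.bgrad p u (1 - i) (D.opp i x))
              (outerNormal (D.sub i) x) * D.bval φ i x -
            avgRho ρ i / D.h * (D.bval u i x - D.bval u (1 - i) (D.opp i x)) * D.bval φ i x)
              ∂(surf (m + 1))| ≤ C * (W * D.dG ρ φ) := by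
  obtain ⟨c, hc0, hc⟩ := exists_integral_mul_bval_le m k (M := M) (lam := lam) hp hp2 hθ hL hρ
  obtain ⟨K, hK⟩ := exists_lipschitzOnWith_opp (m + 1) hM hlam
  have hp0 : 0 < p := by linarith
  have hav := avgRho_pos hρ
  set κ : ℝ := ((K : ℝ) ^ m) ^ (1 / p) with hκ
  have hκ0 : 0 ≤ κ := by positivity
  -- The penalty weights on the two faces differ, since `{ρ}` does; `τ` collects their ratio and the
  -- distortion of surface measure when the opposite trace is transported.
  set τ : ℝ := Real.sqrt ((K : ℝ) ^ m * (avgRho ρ i / avgRho ρ (1 - i))) with hτ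
  have hi := hρ i
  have hj := hρ (1 - i)
  -- The first summand serves the outer flux; the bracket serves the face: own flux, transported
  -- flux, own part of the jump, transported part of the jump.
  refine ⟨ρ i * c + (ρ i / 2 * c + ρ (1 - i) / 2 * (κ * c) + 1 + τ), by positivity, ?_⟩
  intro D hD u φ hφ W hXW hEW
  have hh := D.h_pos m.succ_pos
  set Y := D.dG ρ φ with hY
  set X := D.dG ρ u with hX
  have hY0 : 0 ≤ Y := D.dG_nonneg ρ φ
  have hX0 : 0 ≤ X := D.dG_nonneg ρ u
  have hW0 : 0 ≤ W := hX0.trans hXW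
  have hWY : 0 ≤ W * Y := mul_nonneg hW0 hY0
  set σ := D.h ^ ((1 + ((m + 1 : ℕ) : ℝ) * (p - 2) / 2) / p) with hσ
  have hσ0 : 0 ≤ σ := Real.rpow_nonneg hh.le _
  have hpair : ∀ S ⊆ frontier (D.sub i),
      MeasureTheory.IntegrableOn (fun x => ‖D.bgrad p u i x‖ * |D.bval φ i x|) S (surf (m + 1)) ∧
      ∫ x in S, ‖D.bgrad p u i x‖ * |D.bval φ i x| ∂surf (m + 1) ≤ c * (W * Y) := by
    intro S hS
    obtain ⟨h1, h2⟩ := hc D hD φ hφ i S hS (fun x => ‖D.bgrad p u i x‖) (fun x => norm_nonneg _)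
      (D.memLp_bgrad p u i hS).norm
    refine ⟨h1, h2.trans ?_⟩
    have h3 := mul_le_mul_of_nonneg_right (D.surfNorm_bgrad_mono hp0 u i hS)
      (show 0 ≤ c * (σ * Y) by positivity)
    refine h3.trans ?_
    calc _ = c * ((σ * surfNorm p (frontier (D.sub i)) (D.bgrad p u i)) * Y) := by ring
      _ ≤ c * (W * Y) := by gcongr; exact hEW i
  constructor
  · obtain ⟨h1, h2⟩ := hpair _ (D.outer_subset_frontier i)
    rw [← Real.norm_eq_abs]
    refine (MeasureTheory.norm_integral_le_of_norm_le (h1.const_mul (ρ i))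
      (Filter.Eventually.of_forall fun x => ?_)).trans ?_
    · rw [norm_mul, norm_mul, Real.norm_of_nonneg hi.le, mul_assoc, Real.norm_eq_abs (D.bval φ i x)]
      gcongr
      exact (norm_inner_le_norm _ _).trans
        (mul_le_of_le_one_right (norm_nonneg _) (norm_outerNormal_le_one _ _))
    · rw [MeasureTheory.integral_const_mul, add_mul, mul_assoc]
      exact (mul_le_mul_of_nonneg_left h2 hi.le).trans
        (le_add_of_nonneg_right (by positivity))
  · have hS := D.face_subset_frontier i
    have hS' := D.face_subset_frontier (1 - i)
    have hK' := hK D m.succ_pos hD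
    obtain ⟨i1, b1⟩ := hpair _ hS
    obtain ⟨m2, n2⟩ := hD.memLp_comp_opp hM hlam hK' i hp0 (D.memLp_bgrad p u (1 - i) hS')
    obtain ⟨i2, b2⟩ := hc D hD φ hφ i _ hS (fun x => ‖D.bgrad p u (1 - i) (D.opp i x)‖)
      (fun x => norm_nonneg _) m2.norm
    have b2' : ∫ x in D.face i, ‖D.bgrad p u (1 - i) (D.opp i x)‖ * |D.bval φ i x|
        ∂surf (m + 1) ≤ κ * c * (W * Y) := by
      have h3 : (∫ x in D.face i, ‖D.bgrad p u (1 - i) (D.opp i x)‖ ^ p ∂surf (m + 1)) ^ (1 / p) ≤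
          κ * surfNorm p (frontier (D.sub (1 - i))) (D.bgrad p u (1 - i)) := by
        refine (Real.rpow_le_rpow (MeasureTheory.integral_nonneg fun x => by positivity) n2
          (by positivity)).trans ?_
        rw [Real.mul_rpow (by positivity)
          (MeasureTheory.integral_nonneg fun x => by positivity)]
        exact mul_le_mul_of_nonneg_left (D.surfNorm_bgrad_mono hp0 u (1 - i) hS') hκ0
      refine b2.trans ((mul_le_mul_of_nonneg_right h3
        (show 0 ≤ c * (σ * Y) by positivity)).trans ?_)
      calc _ = κ * c * ((σ * surfNorm p (frontier (D.sub (1 - i))) (D.bgrad p u (1 - i))) * Y) := by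
            ring
        _ ≤ κ * c * (W * Y) := by gcongr; exact hEW (1 - i)
    have hch : 0 ≤ avgRho ρ i / D.h := div_nonneg (hav i).le hh.le
    have hφi := D.memLp_bval φ i hS
    have hφY := (D.dG_terms_le m.succ_pos hρ φ i).2.2
    have i3 : MeasureTheory.IntegrableOn (fun x => |D.bval u i x| * |D.bval φ i x|) (D.face i)
        (surf (m + 1)) := (D.memLp_bval u i hS).norm.integrable_mul hφi.norm
    have b3 := mul_integral_abs_mul_abs_le (D.memLp_bval u i hS) hφi hch hX0 hY0
      (D.dG_terms_le m.succ_pos hρ u i).2.2 hφY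
    obtain ⟨m4, n4⟩ := hD.memLp_comp_opp hM hlam hK' i two_pos
      (f := D.bval u (1 - i)) (by simpa using D.memLp_bval u (1 - i) hS')
    rw [ENNReal.ofReal_ofNat] at m4
    simp only [Real.rpow_two, Real.norm_eq_abs, sq_abs] at n4
    have i4 : MeasureTheory.IntegrableOn
        (fun x => |D.bval u (1 - i) (D.opp i x)| * |D.bval φ i x|) (D.face i)
        (surf (m + 1)) := m4.norm.integrable_mul hφi.norm
    have hb4 : avgRho ρ i / D.h *
        ∫ x in D.face i, D.bval u (1 - i) (D.opp i x) ^ 2 ∂surf (m + 1) ≤ (τ * X) ^ 2 := by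
      have hj' := (D.dG_terms_le m.succ_pos hρ u (1 - i)).2.2
      have hai := hav i
      have haj := hav (1 - i)
      rw [mul_pow, hτ, Real.sq_sqrt (by positivity)]
      calc _ ≤ avgRho ρ i / D.h * ((K : ℝ) ^ m *
            ∫ x in D.face (1 - i), D.bval u (1 - i) x ^ 2 ∂surf (m + 1)) :=
            mul_le_mul_of_nonneg_left n4 hch
        _ = (K : ℝ) ^ m * (avgRho ρ i / avgRho ρ (1 - i)) * (avgRho ρ (1 - i) / D.h *
            ∫ x in D.face (1 - i), D.bval u (1 - i) x ^ 2 ∂surf (m + 1)) := by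
            field_simp
        _ ≤ _ := mul_le_mul_of_nonneg_left hj' (by positivity)
    have b4 := mul_integral_abs_mul_abs_le m4 hφi hch (mul_nonneg (Real.sqrt_nonneg _) hX0) hY0
      hb4 hφY
    have hint := (((i1.const_mul (ρ i / 2)).add (i2.const_mul (ρ (1 - i) / 2))).add
      (i3.const_mul (avgRho ρ i / D.h))).add (i4.const_mul (avgRho ρ i / D.h))
    rw [← Real.norm_eq_abs]
    refine (MeasureTheory.norm_integral_le_of_norm_le hint (Filter.Eventually.of_forall fun x =>
      norm_face_integrand_le (by positivity) (by positivity) hch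
        (norm_outerNormal_le_one _ _))).trans ?_
    rw [MeasureTheory.integral_add' (((i1.const_mul (ρ i / 2)).add
        (i2.const_mul (ρ (1 - i) / 2))).add (i3.const_mul (avgRho ρ i / D.h)))
        (i4.const_mul (avgRho ρ i / D.h)),
      MeasureTheory.integral_add' ((i1.const_mul (ρ i / 2)).add (i2.const_mul (ρ (1 - i) / 2)))
        (i3.const_mul (avgRho ρ i / D.h)),
      MeasureTheory.integral_add' (i1.const_mul (ρ i / 2)) (i2.const_mul (ρ (1 - i) / 2)),
      MeasureTheory.integral_const_mul, MeasureTheory.integral_const_mul,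
      MeasureTheory.integral_const_mul, MeasureTheory.integral_const_mul]
    have e1 := mul_le_mul_of_nonneg_left b1 (show 0 ≤ ρ i / 2 by positivity)
    have e2 := mul_le_mul_of_nonneg_left b2' (show 0 ≤ ρ (1 - i) / 2 by positivity)
    have e3 : X * Y ≤ W * Y := mul_le_mul_of_nonneg_right hXW hY0
    have e4 : τ * (X * Y) ≤ τ * (W * Y) := mul_le_mul_of_nonneg_left e3 (Real.sqrt_nonneg _)
    have e5 : 0 ≤ ρ i * c * (W * Y) := by positivity
    linarith

/-- The quantity `T ^ (1 / p)` dominates the dG norm and each scaled gradient trace separately,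
since each has its `p`-th power among the nonnegative summands of `T`. It therefore serves as the
common bound `W`. -/
theorem exists_abs_B_le (m k : ℕ) {p L θ M lam : ℝ} {ρ : Fin 2 → ℝ} (hp : 1 < p)
    (hp2 : p ≤ 2) (hlam : 0 ≤ lam) (hθ : 0 < θ) (hL : 0 < L) (hM : 0 ≤ M) (hρ : ∀ i, 0 < ρ i) :
    ∃ C : ℝ, 0 ≤ C ∧
      ∀ D : GapDecomposition (m + 1) k, D.Regular L θ M lam →
        ∀ (u : Space (m + 1) → ℝ), ∀ φ ∈ D.Vh,
          |D.B ρ p u φ| ≤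
            C * ((D.dG ρ u) ^ p +
              ∑ i : Fin 2, D.h ^ (1 + ((m + 1 : ℕ) : ℝ) * (p - 2) / 2) *
                (surfNorm p (frontier (D.sub i)) (D.bgrad p u i)) ^ p) ^ (1 / p) *
              D.dG ρ φ := by
  choose C hC0 hC using exists_abs_boundary_terms_le m k hp hp2 hlam hθ hL hM hρ
  -- For each patch, 2 counts the volume term and the outer penalty, and `2 * C i` the outer flux
  -- and the face integral.
  refine ⟨∑ i, (2 + 2 * C i),
    Finset.sum_nonneg fun i _ => by linarith [hC0 i], fun D hD u φ hφ => ?_⟩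
  have hp0 : 0 < p := by linarith
  have hh := D.h_pos m.succ_pos
  have hX0 := D.dG_nonneg ρ u
  have hY0 := D.dG_nonneg ρ φ
  have hE0 : ∀ i, 0 ≤ D.h ^ (1 + ((m + 1 : ℕ) : ℝ) * (p - 2) / 2) *
      (surfNorm p (frontier (D.sub i)) (D.bgrad p u i)) ^ p := fun i =>
    mul_nonneg (Real.rpow_nonneg hh.le _) (Real.rpow_nonneg (surfNorm_nonneg _ _ _) _)
  set T := (D.dG ρ u) ^ p + ∑ i : Fin 2, D.h ^ (1 + ((m + 1 : ℕ) : ℝ) * (p - 2) / 2) *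
    (surfNorm p (frontier (D.sub i)) (D.bgrad p u i)) ^ p with hT
  have hXT : D.dG ρ u ≤ T ^ (1 / p) := by
    rw [one_div, Real.le_rpow_inv_iff_of_pos hX0 ?_ hp0]
    · exact le_add_of_nonneg_right (Finset.sum_nonneg fun i _ => hE0 i)
    · exact add_nonneg (Real.rpow_nonneg hX0 _) (Finset.sum_nonneg fun i _ => hE0 i)
  have hET : ∀ j, D.h ^ ((1 + ((m + 1 : ℕ) : ℝ) * (p - 2) / 2) / p) *
      surfNorm p (frontier (D.sub j)) (D.bgrad p u j) ≤ T ^ (1 / p) := by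
    intro j
    rw [one_div, Real.le_rpow_inv_iff_of_pos
      (mul_nonneg (Real.rpow_nonneg hh.le _) (surfNorm_nonneg _ _ _)) ?_ hp0,
      Real.mul_rpow (Real.rpow_nonneg hh.le _) (surfNorm_nonneg _ _ _), ← Real.rpow_mul hh.le,
      div_mul_cancel₀ _ hp0.ne']
    · exact (Finset.single_le_sum (fun i _ => hE0 i) (Finset.mem_univ j)).trans
        (le_add_of_nonneg_left (Real.rpow_nonneg hX0 _))
    · exact add_nonneg (Real.rpow_nonneg hX0 _) (Finset.sum_nonneg fun i _ => hE0 i)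
  rw [mul_assoc, Finset.sum_mul]
  refine (Finset.abs_sum_le_sum_abs _ _).trans (Finset.sum_le_sum fun i _ => ?_)
  obtain ⟨h2, h3⟩ := hC i D hD u φ hφ _ hXT hET
  have h1 := D.abs_integral_grad_le m.succ_pos hρ u φ i
  have h4 := D.abs_integral_outer_le m.succ_pos hρ u φ i
  have h5 := mul_le_mul_of_nonneg_right hXT hY0
  rw [abs_le] at h1 h2 h3 h4 ⊢
  constructor <;> linarith [h1.1, h1.2, h2.1, h2.2, h3.1, h3.2, h4.1, h4.2]

end GapDecomposition

end DGIgA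

end

theorem lemma3p3 (d k l : ℕ) (p lam θ L M : ℝ) (ρ : Fin 2 → ℝ)
    (hd : 2 ≤ d) (hl : 2 ≤ l) (hk : l ≤ k)
    (hp : max 1 (2 * (d : ℝ) / ((d : ℝ) + 2 * ((l : ℝ) - 1))) < p) (hp2 : p ≤ 2)
    (hlam : 1 ≤ lam) (hθ : 1 ≤ θ) (hL : 1 ≤ L) (hM : 0 ≤ M) (hρ : ∀ i, 0 < ρ i) :
    ∃ C : ℝ, 0 ≤ C ∧
      ∀ D : DGIgA.GapDecomposition d k, D.Regular L θ M lam →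
        ∀ u ∈ D.VplusVh l p, ∀ φ ∈ D.Vh,
          |D.B ρ p u φ| ≤
            C * ((D.dG ρ u) ^ p +
              ∑ i : Fin 2, D.h ^ (1 + (d : ℝ) * (p - 2) / 2) *
                (DGIgA.surfNorm p (frontier (D.sub i)) (D.bgrad p u i)) ^ p) ^ (1 / p) *
              D.dG ρ φ := by
  -- With `d = m + 1` the surface dimension is `m`, without truncated subtraction.
  obtain ⟨m, rfl⟩ : ∃ m, d = m + 1 := ⟨d - 1, by omega⟩
  obtain ⟨C, hC0, hC⟩ := DGIgA.GapDecomposition.exists_abs_B_le m k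
    ((le_max_left _ _).trans_lt hp) hp2 (zero_le_one.trans hlam) (by linarith : 0 < θ)
    (by linarith : 0 < L) hM hρ
  exact ⟨C, hC0, fun D hD u _ φ hφ => hC D hD u φ hφ⟩
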